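/- All graphs are finite, undirected and simple; eigenvalues of a graph are those of its adjacency matrix $A(\Gamma)$. Let $\mathscr G_3$ be the set of connected graphs with exactly three distinct eigenvalues, and $\mathscr G_3(\theta_0,\theta_1,\theta_2)$ the subset of those whose distinct eigenvalues are $\theta_0>\theta_1>\theta_2$. A coherent algebra on a finite set $\mathfrak X$ is a matrix algebra $\mathcal A\subseteq \mathrm{Mat}_{\mathfrak X}(\mathbb C)$ that contains $I$ and the all-ones matrix $J$ and is closed under transposition and entrywise multiplication. It has a unique basis of $\{0,1\}$-matrices, the matrices of relations $R_1,\dots,R_r$ that partition $\mathfrak X\times\mathfrak X$; $r$ is its rank. The fibres are the sets $\mathfrak X_i=\{\mathsf x:(\mathsf x,\mathsf x)\in R_i\}$ for the relations $R_i$ contained in the identity relation, and the type is the (symmetric) matrix, indexed by the fibres, whose $(i,j)$-entry is the number of relations $R_k\subseteq\mathfrak X_i\times\mathfrak X_j$ (entries below the diagonal are omitted). The coherent closure $\mathcal W(\Gamma)$ is the smallest coherent algebra containing $A(\Gamma)$, and the coherent rank of $\Gamma$ is the rank of $\mathcal W(\Gamma)$. A quasi-symmetric design (QSD) with parameters $(v,k,\lambda;b,r,\{x,y\})$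 consists of $v$ points and a family of $b$ blocks (repetition allowed), each a set of $k$ points, $1\le k\le v$, such that any two distinct points lie in exactly $\lambda$ blocks, each point lies in exactly $r$ blocks, any two blocks meet in $x$ or $y$ points, both numbers occur, and $x\ne y$. Its incidence matrix has rows indexed by points and columns by blocks; its $x$-block graph $\mathsf B_x(\mathcal Q)$ has the blocks as vertices, two distinct blocks being adjacent when they meet in exactly $x$ points. An eigenvalue of a graph is restricted if it has an eigenvector perpendicular to the all-ones vector. **Theorem.** Let $\Gamma\in\mathscr G_3$ have coherent rank $9$. Then $\mathcal W(\Gamma)$ has type $\left[\begin{smallmatrix}2&2\\&3\end{smallmatrix}\right]$. In particular: (i) $\Gamma$ is biregular: its vertices have exactly two distinct degrees $k_1\neq k_2$. The sets $V_1,V_2$ of vertices of degree $k_1$, $k_2$, suitably numbered, are the fibres of $\mathcal W(\Gamma)$, in the order of the type matrix above, and $\{V_1,V_2\}$ is equitable, with quotient matrix $\left[\begin{smallmatrix}k_{11}&k_{12}\\k_{21}&k_{22}\end{smallmatrix}\right]$: each vertex of $V_i$ has exactly $k_{ij}$ neighbours in $V_j$. Put $n_i=|V_i|$. (ii) $A(\Gamma)=\left[\begin{smallmatrix}\varepsilon(J-I)&M\\M^\top&A(\Gamma[V_2])\end{smallmatrix}\right]$,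 where $\varepsilon\in\{0,1\}$, $M$ is the incidence matrix of a QSD $\mathcal Q$ with parameters $(n_1,k_{21},\lambda;n_2,k_{12},\{x,y\})$, and $\Gamma[V_2]=\mathsf B_x(\mathcal Q)$. (iii) $\mathsf B_x(\mathcal Q)$ has exactly two restricted eigenvalues $e_1>e_2$, and if $\Gamma\in\mathscr G_3(\theta_0,\theta_1,\theta_2)$ then either $\theta_1=e_1=\frac{y-k_{21}}{x-y}$ or $\theta_2=e_2=\frac{y-k_{21}}{x-y}$. Furthermore $$(x,y)=\bigl(k_{21}+(\theta_1+1)(\theta_2+1)-(e_1+1)(e_2+1),\; k_{21}+\theta_1\theta_2-e_1e_2\bigr),$$ $(k_1+\theta_1\theta_2)(k_2+\theta_1\theta_2)\ge 0$, and, if $\Gamma[V_1]$ is empty, $$\lambda-k_{12}=\theta_1\theta_2,\qquad \frac{k_{12}-\lambda+y-k_{21}}{x-y}=\theta_1+\theta_2,\qquad \sqrt{(k_1+\theta_1\theta_2)(k_2+\theta_1\theta_2)}=\frac{\lambda k_{21}-yk_{12}}{x-y},$$ while, if $\Gamma[V_1]$ is complete, $$\lambda-k_{12}=(\theta_1+1)(\theta_2+1),\qquad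 \frac{k_{12}-\lambda+y-k_{21}}{x-y}=\theta_1+\theta_2+1,\qquad \sqrt{(k_1+\theta_1\theta_2)(k_2+\theta_1\theta_2)}=k_{21}+\frac{\lambda k_{21}-yk_{12}}{x-y}.$$ -/

import Mathlib

namespace ThreeEv

noncomputable section

/-! ### Graphs with three distinct eigenvalues -/

/-- `𝒢₃`: connected graphs whose adjacency matrix has exactly three distinct eigenvalues. -/
def InG3 {V : Type*} [Fintype V] [DecidableEq V] (G : SimpleGraph V) [DecidableRel G.Adj] : Prop :=
  G.Connected ∧ (spectrum ℝ (G.adjMatrix ℝ)).ncard = 3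

/-- `𝒢₃(θ₀, θ₁, θ₂)`: connected graphs whose distinct eigenvalues are `θ₀ > θ₁ > θ₂`. -/
def InG3With {V : Type*} [Fintype V] [DecidableEq V] (G : SimpleGraph V) [DecidableRel G.Adj]
    (θ₀ θ₁ θ₂ : ℝ) : Prop :=
  G.Connected ∧ θ₁ < θ₀ ∧ θ₂ < θ₁ ∧ spectrum ℝ (G.adjMatrix ℝ) = {θ₀, θ₁, θ₂}

/-- The eigenvalues of a graph that have an eigenvector perpendicular to the all-ones vector. -/
def restrictedEigenvalues {W : Type*} [Fintype W] (H : SimpleGraph W) [DecidableRel H.Adj] :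
    Set ℝ :=
  {e | ∃ u : W → ℝ, u ≠ 0 ∧ ∑ w, u w = 0 ∧ (H.adjMatrix ℝ).mulVec u = e • u}

/-! ### Coherent algebras -/

/-- The all-ones matrix. -/
def allOnes (m n : Type*) (R : Type*) [One R] : Matrix m n R := Matrix.of fun _ _ => 1

/-- A matrix algebra (it contains `I` and is closed under linear combinations and products) is
coherent if it contains `J` and is closed under transposition and entrywise products. -/
structure IsCoherent {V : Type*} [Fintype V] [DecidableEq V]
    (S : Subalgebra ℂ (Matrix V V ℂ)) : Prop where
  allOnes_mem : allOnes V V ℂ ∈ S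
  transpose_mem : ∀ M ∈ S, M.transpose ∈ S
  hadamard_mem : ∀ M ∈ S, ∀ N ∈ S, Matrix.hadamard M N ∈ S

/-- The coherent closure of `G`: the smallest coherent algebra containing its adjacency matrix. -/
def coherentClosure {V : Type*} [Fintype V] [DecidableEq V] (G : SimpleGraph V)
    [DecidableRel G.Adj] : Subalgebra ℂ (Matrix V V ℂ) :=
  sInf {S | IsCoherent S ∧ G.adjMatrix ℂ ∈ S}

/-- The relation through the pair `p`: all pairs at which every matrix of `S` has the same entry
as at `p`. -/
def relationThrough {V : Type*} [Fintype V] [DecidableEq V] (S : Subalgebra ℂ (Matrix V V ℂ))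
    (p : V × V) : Set (V × V) :=
  {q | ∀ M ∈ S, M q.1 q.2 = M p.1 p.2}

/-- The relations of the coherent configuration of a coherent algebra `S`. Their `{0,1}`-matrices
form the basis of `S`, see `linearIndependent_relationMatrix` and `span_relationMatrix`. -/
def basicRelations {V : Type*} [Fintype V] [DecidableEq V] (S : Subalgebra ℂ (Matrix V V ℂ)) :
    Set (Set (V × V)) :=
  Set.range (relationThrough S)

/-- The rank: the number of relations of the coherent configuration. -/
def rank {V : Type*} [Fintype V] [DecidableEq V] (S : Subalgebra ℂ (Matrix V V ℂ)) : ℕ :=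
  (basicRelations S).ncard

/-- The fibres: the sets `{x | (x, x) ∈ R}` for the relations `R` contained in the identity. -/
def fibres {V : Type*} [Fintype V] [DecidableEq V] (S : Subalgebra ℂ (Matrix V V ℂ)) :
    Set (Set V) :=
  {F | ∃ R ∈ basicRelations S, R ⊆ Set.diagonal V ∧ F = {x | (x, x) ∈ R}}

/-- The entry of the type matrix at the fibres `F`, `F'`. -/
def typeEntry {V : Type*} [Fintype V] [DecidableEq V] (S : Subalgebra ℂ (Matrix V V ℂ))
    (F F' : Set V) : ℕ :=
  {R | R ∈ basicRelations S ∧ R ⊆ F ×ˢ F'}.ncard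

/-- `F` lists the fibres of `S` without repetition, and `T` is the type matrix of `S` with respect
to this ordering of the fibres. -/
structure HasTypeWith {V : Type*} [Fintype V] [DecidableEq V] (S : Subalgebra ℂ (Matrix V V ℂ))
    {d : ℕ} (F : Fin d → Set V) (T : Matrix (Fin d) (Fin d) ℕ) : Prop where
  injective : Function.Injective F
  range_eq : Set.range F = fibres S
  entry : ∀ i j, typeEntry S (F i) (F j) = T i j

/-- `S` has type `T`, for a suitable ordering of its fibres. -/
def HasType {V : Type*} [Fintype V] [DecidableEq V] (S : Subalgebra ℂ (Matrix V V ℂ))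
    {d : ℕ} (T : Matrix (Fin d) (Fin d) ℕ) : Prop :=
  ∃ F : Fin d → Set V, HasTypeWith S F T

/-- The coherent rank of a graph: the rank of its coherent closure. -/
def coherentRank {V : Type*} [Fintype V] [DecidableEq V] (G : SimpleGraph V)
    [DecidableRel G.Adj] : ℕ :=
  rank (coherentClosure G)

/-! ### The valency partition -/

/-- `G` is biregular: its vertices have exactly the two distinct degrees `k₁ ≠ k₂`, and `V₁`, `V₂`
are the sets of vertices of degree `k₁`, `k₂`. -/
structure IsBiregular {V : Type*} [Fintype V] [DecidableEq V] (G : SimpleGraph V)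
    [DecidableRel G.Adj] (k₁ k₂ : ℕ) (V₁ V₂ : Finset V) : Prop where
  ne : k₁ ≠ k₂
  degrees : Set.range (fun x => G.degree x) = {k₁, k₂}
  mem₁ : ∀ x, x ∈ V₁ ↔ G.degree x = k₁
  mem₂ : ∀ x, x ∈ V₂ ↔ G.degree x = k₂

/-- Every vertex of `P i` has exactly `Q i j` neighbours in `P j`: the partition `P` is equitable
with quotient matrix `Q`. -/
def IsEquitable {V : Type*} [Fintype V] [DecidableEq V] (G : SimpleGraph V) [DecidableRel G.Adj]
    {t : ℕ} (P : Fin t → Finset V) (Q : Matrix (Fin t) (Fin t) ℕ) : Prop :=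
  ∀ i j, ∀ x ∈ P i, (G.neighborFinset x ∩ P j).card = Q i j

/-! ### Quasi-symmetric designs -/

/-- The family `blk` of subsets of `P`, indexed by `B` (so that blocks may be repeated), is a
`2`-`(v, k, lam)` design. -/
structure IsTwoDesign {P B : Type*} [Fintype P] [DecidableEq P] [Fintype B]
    (blk : B → Finset P) (v k lam : ℕ) : Prop where
  card_points : Fintype.card P = v
  one_le : 1 ≤ k
  le : k ≤ v
  card_block : ∀ i, (blk i).card = k
  card_pair : ∀ p q : P, p ≠ q →
    (Finset.univ.filter fun i => p ∈ blk i ∧ q ∈ blk i).card = lam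

/-- `blk` is a quasi-symmetric design with parameters `(v, k, lam; b, r, {x, y})`: a
`2`-`(v, k, lam)` design with `b` blocks, `r` of them through each point, in which any two blocks
meet in `x` or `y` points, where `x ≠ y` and both numbers occur. -/
structure IsQSD {P B : Type*} [Fintype P] [DecidableEq P] [Fintype B]
    (blk : B → Finset P) (v k lam b r x y : ℕ) : Prop where
  twoDesign : IsTwoDesign blk v k lam
  card_blocks : Fintype.card B = b
  replication : ∀ p : P, (Finset.univ.filter fun i => p ∈ blk i).card = r
  ne : x ≠ y
  inter : ∀ i j, i ≠ j → (blk i ∩ blk j).card = x ∨ (blk i ∩ blk j).card = y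
  occurs_x : ∃ i j, i ≠ j ∧ (blk i ∩ blk j).card = x
  occurs_y : ∃ i j, i ≠ j ∧ (blk i ∩ blk j).card = y

/-- The incidence matrix, with rows indexed by points and columns by blocks. -/
def incidenceMatrix {P B : Type*} [DecidableEq P] (blk : B → Finset P) : Matrix P B ℝ :=
  Matrix.of fun p i => if p ∈ blk i then 1 else 0

/-- The `x`-block graph: distinct blocks are adjacent when they meet in exactly `x` points. -/
def blockGraph {P B : Type*} [DecidableEq P] (blk : B → Finset P) (x : ℕ) : SimpleGraph B where
  Adj i j := i ≠ j ∧ (blk i ∩ blk j).card = x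
  symm := ⟨fun i j h => ⟨h.1.symm, by rw [Finset.inter_comm]; exact h.2⟩⟩
  loopless := ⟨fun _ h => h.1 rfl⟩

/-! ### Facts showing that the definitions fit together -/

section facts

variable {V : Type*} [Fintype V] [DecidableEq V]

theorem isCoherent_coherentClosure (G : SimpleGraph V) [DecidableRel G.Adj] :
    IsCoherent (coherentClosure G) := by
  refine ⟨?_, ?_, ?_⟩
  · simp only [coherentClosure, Algebra.mem_sInf]
    exact fun S hS => hS.1.allOnes_mem
  · simp only [coherentClosure, Algebra.mem_sInf]
    exact fun M hM S hS => hS.1.transpose_mem M (hM S hS)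
  · simp only [coherentClosure, Algebra.mem_sInf]
    exact fun M hM N hN S hS => hS.1.hadamard_mem M (hM S hS) N (hN S hS)

theorem adjMatrix_mem_coherentClosure (G : SimpleGraph V) [DecidableRel G.Adj] :
    G.adjMatrix ℂ ∈ coherentClosure G := by
  simp only [coherentClosure, Algebra.mem_sInf]
  exact fun S hS => hS.2

open Classical in
/-- The `{0,1}`-matrix of a relation. -/
def relationMatrix (R : Set (V × V)) : Matrix V V ℂ :=
  Matrix.of fun x y => if (x, y) ∈ R then 1 else 0

theorem relationMatrix_mem {S : Subalgebra ℂ (Matrix V V ℂ)} (hS : IsCoherent S)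
    {R : Set (V × V)} (hR : R ∈ basicRelations S) : relationMatrix R ∈ S := by
  obtain ⟨p, rfl⟩ := hR
  have key : ∀ T : Finset (V × V), (∀ q ∈ T, q ∉ relationThrough S p) →
      ∃ N ∈ S, N p.1 p.2 = 1 ∧ ∀ q ∈ T, N q.1 q.2 = 0 := by
    classical
    intro T
    induction T using Finset.induction_on with
    | empty => exact fun _ => ⟨_, hS.allOnes_mem, rfl, by simp⟩
    | insert a T ha ih =>
      intro h
      obtain ⟨N, hN, h1, h0⟩ := ih fun q hq => h q (Finset.mem_insert_of_mem hq)
      have hn := h a (Finset.mem_insert_self _ _)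
      simp only [relationThrough, Set.mem_ofPred_eq, not_forall] at hn
      obtain ⟨M, hM, hne⟩ := hn
      have hne' : M p.1 p.2 - M a.1 a.2 ≠ 0 := sub_ne_zero.2 (Ne.symm hne)
      refine ⟨Matrix.hadamard N ((M p.1 p.2 - M a.1 a.2)⁻¹ • (M - M a.1 a.2 • allOnes V V ℂ)),
        hS.hadamard_mem _ hN _ (S.smul_mem (S.sub_mem hM (S.smul_mem hS.allOnes_mem _)) _), ?_, ?_⟩
      · simp [allOnes, h1, hne']
      · intro q hq
        rcases Finset.mem_insert.1 hq with rfl | hq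
        · simp [allOnes]
        · simp [h0 q hq]
  classical
  obtain ⟨N, hN, h1, h0⟩ := key (Finset.univ.filter fun q => q ∉ relationThrough S p) (by simp)
  convert hN using 1
  ext x y
  by_cases h : (x, y) ∈ relationThrough S p
  · simp only [relationMatrix, Matrix.of_apply, h, if_true]
    rw [h N hN, h1]
  · simp only [relationMatrix, Matrix.of_apply, h, if_false]
    exact (h0 (x, y) (by simpa using h)).symm

theorem relationThrough_eq {S : Subalgebra ℂ (Matrix V V ℂ)} {R : Set (V × V)}
    (hR : R ∈ basicRelations S) {p : V × V} (hp : p ∈ R) : R = relationThrough S p := by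
  obtain ⟨q, rfl⟩ := hR
  ext z
  exact ⟨fun h M hM => (h M hM).trans (hp M hM).symm, fun h M hM => (h M hM).trans (hp M hM)⟩

theorem linearIndependent_relationMatrix (S : Subalgebra ℂ (Matrix V V ℂ)) :
    LinearIndependent ℂ (fun R : basicRelations S => relationMatrix (R : Set (V × V))) := by
  classical
  rw [Fintype.linearIndependent_iff]
  intro g hg ⟨R, p, hp⟩
  have hpR : p ∈ R := by rw [← hp]; exact fun M _ => rfl
  have h := congrFun (congrFun hg p.1) p.2
  rw [Matrix.sum_apply, Finset.sum_eq_single ⟨R, p, hp⟩] at h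
  · simpa [relationMatrix, hpR] using h
  · intro R' _ hne
    have : p ∉ (R' : Set (V × V)) := fun hp' => hne (Subtype.ext
      ((relationThrough_eq R'.2 hp').trans hp))
    simp [relationMatrix, this]
  · simp

theorem span_relationMatrix {S : Subalgebra ℂ (Matrix V V ℂ)} (hS : IsCoherent S) :
    Submodule.span ℂ (Set.range fun R : basicRelations S => relationMatrix (R : Set (V × V)))
      = Subalgebra.toSubmodule S := by
  classical
  apply le_antisymm
  · rw [Submodule.span_le]
    rintro _ ⟨R, rfl⟩
    exact relationMatrix_mem hS R.2
  · intro M hM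
    have hrep : ∀ R : basicRelations S, ∃ p, p ∈ (R : Set (V × V)) := by
      rintro ⟨_, p, rfl⟩
      exact ⟨p, fun M _ => rfl⟩
    choose c hc using hrep
    have hsum : M = ∑ R : basicRelations S,
        M (c R).1 (c R).2 • relationMatrix (R : Set (V × V)) := by
      ext x y
      rw [Matrix.sum_apply, Finset.sum_eq_single ⟨relationThrough S (x, y), (x, y), rfl⟩]
      · have hmem : (x, y) ∈ relationThrough S (x, y) := fun M _ => rfl
        have := hc ⟨relationThrough S (x, y), (x, y), rfl⟩ M hM
        simp only [Matrix.smul_apply, relationMatrix, Matrix.of_apply, hmem, if_true, smul_eq_mul,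
          mul_one]
        exact this.symm
      · intro R' _ hne
        have : (x, y) ∉ (R' : Set (V × V)) := fun hp' =>
          hne (Subtype.ext (relationThrough_eq R'.2 hp'))
        simp [relationMatrix, this]
      · simp
    rw [hsum]
    exact Submodule.sum_mem _ fun R _ =>
      Submodule.smul_mem _ _ (Submodule.subset_span ⟨R, rfl⟩)

/-- The rank of a coherent algebra is its dimension. -/
theorem rank_eq_finrank {S : Subalgebra ℂ (Matrix V V ℂ)} (hS : IsCoherent S) :
    rank S = Module.finrank ℂ S := by
  classical
  have h := finrank_span_eq_card (linearIndependent_relationMatrix S)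
  rw [span_relationMatrix hS] at h
  rw [rank, Set.ncard_eq_toFinset_card', Set.toFinset_card]
  exact h.symm

end facts

end

end ThreeEv

open ThreeEv

namespace ThreeEv

open Matrix

set_option linter.unusedSectionVars false

/-! ### The spectral identity of a graph with three eigenvalues -/

section spectral

variable {V : Type*} [Fintype V] [DecidableEq V]

/-! Put τ = θ₁ + θ₂ and δ = θ₁θ₂. By Perron–Frobenius θ₀ is simple with a positive eigenvector, so
(A - θ₁)(A - θ₂) = ααᵀ with α > 0 (`InG3With.exists_pos_vector`). Its diagonal reads deg(x) + δ =
α(x)², so α depends on the degree only, and between valency classes A² is a combination of A, I and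
J.

Call a block of A flat if it has the form sJ + tI. Take an equitable partition into two cells on
which α is constant, with a flat block in each row of blocks. Paths of length two through the flat
block are counted directly, those through the other cell follow from A²; hence the blockwise
combinations of I, A and J form a coherent algebra (`isBlockCombination_of_mem_coherentClosure`).
This bounds the rank by 3 for regular graphs and by 8 for a join of two fibres, and leaves at most
two relations on a fibre when both diagonal blocks are flat.

Let the rank be 9. Three fibres already use up nine relations, which forces three vertices, and a
connected graph on three vertices has a transposition as automorphism. So there are two fibres, of
different degrees, and r₁₁ + 2r₁₂ + r₂₂ = 9. Here r₁₂ ≥ 2, since the fibres are neither unjoined nor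
completely joined, and r₁₁, r₂₂ ≥ 2, since a singleton fibre would give r₁₂ = 1. Only (2, 2, 3)
remains, up to order (`IsFibrePair.relationCount_eq`). Thus V₁ is empty or complete, V₂ carries only
equality, adjacency and non-adjacency, and the constant numbers of common neighbours make the
neighbourhoods in V₁ a quasi-symmetric design.

For the eigenvalues, compare the blocks of A² with MMᵀ and MᵀM, where N is the block on V₂, a = k₂₁
and b = k₁₂. On 1^⊥ the matrix N has the eigenvalue τ + ε, from the image of Mᵀ, and (y - a)/(x -
y), from the kernel of M (`IsDesignBlock.restricted_eq`). The second is a root of t² - τt + δ, and λ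
- b = (θ₁ + ε)(θ₂ + ε) < 0 decides which of the two is larger
(`IsDesignBlock.eigenvalue_relations`). -/

theorem isHermitian_adjMatrix {W : Type*} (G : SimpleGraph W) [DecidableRel G.Adj] :
    (G.adjMatrix ℝ).IsHermitian := by
  rw [Matrix.IsHermitian, Matrix.conjTranspose_eq_transpose_of_trivial]
  exact G.isSymm_adjMatrix

/-- A real symmetric matrix is annihilated by the product over its three eigenvalues. -/
theorem mul_mul_eq_zero_of_spectrum {A : Matrix V V ℝ} (hA : A.IsHermitian) {a b c : ℝ}
    (h : spectrum ℝ A = {a, b, c}) :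
    (A - a • (1 : Matrix V V ℝ)) * ((A - b • (1 : Matrix V V ℝ)) * (A - c • (1 : Matrix V V ℝ)))
      = 0 := by
  set φ := Unitary.conjStarAlgAut ℝ (Matrix V V ℝ) hA.eigenvectorUnitary
  set D : Matrix V V ℝ := diagonal (RCLike.ofReal ∘ hA.eigenvalues)
  have hs : A = φ D := hA.spectral_theorem
  have hsub : ∀ t : ℝ, A - t • (1 : Matrix V V ℝ) = φ (D - t • 1) := by
    intro t
    rw [map_sub, map_smul, map_one, ← hs]
  rw [hsub, hsub, hsub, ← map_mul, ← map_mul]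
  have hd : ∀ t : ℝ, D - t • (1 : Matrix V V ℝ) = diagonal fun i => hA.eigenvalues i - t := by
    intro t
    rw [← diagonal_one, ← diagonal_smul, diagonal_sub]
    congr 1
    ext i
    simp
  have hz : (D - a • (1 : Matrix V V ℝ)) * ((D - b • (1 : Matrix V V ℝ)) *
      (D - c • (1 : Matrix V V ℝ))) = 0 := by
    rw [hd, hd, hd, diagonal_mul_diagonal, diagonal_mul_diagonal, ← diagonal_zero]
    congr 1
    ext i
    have := hA.eigenvalues_mem_spectrum_real i
    rw [h] at this
    rcases this with h | h | h <;> simp_all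
  rw [hz, map_zero]

/-- The largest eigenvalue bounds the quadratic form. -/
theorem posSemidef_smul_one_sub {A : Matrix V V ℝ} (hA : A.IsHermitian) {a : ℝ}
    (h : ∀ t ∈ spectrum ℝ A, t ≤ a) : (a • (1 : Matrix V V ℝ) - A).PosSemidef := by
  have hH : (a • (1 : Matrix V V ℝ) - A).IsHermitian := by
    refine Matrix.IsHermitian.sub ?_ hA
    simp [Matrix.IsHermitian]
  rw [hH.posSemidef_iff_eigenvalues_nonneg]
  intro i
  have hm := hH.eigenvalues_mem_spectrum_real i
  generalize hH.eigenvalues i = t at hm ⊢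
  rw [← Algebra.algebraMap_eq_smul_one, ← spectrum.singleton_sub_eq] at hm
  obtain ⟨_, rfl, s, hs, rfl⟩ := hm
  simpa using h s hs

variable (G : SimpleGraph V) [DecidableRel G.Adj]

/-- A nonzero nonnegative eigenvector of a connected graph is positive. -/
theorem pos_of_nonneg_eigenvector (hG : G.Connected) {a : ℝ} {u : V → ℝ} (h0 : ∀ x, 0 ≤ u x)
    (hne : u ≠ 0) (h : G.adjMatrix ℝ *ᵥ u = a • u) (x : V) : 0 < u x := by
  by_contra hx
  have hx0 : u x = 0 := le_antisymm (not_lt.1 hx) (h0 x)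
  obtain ⟨y, hy⟩ := Function.ne_iff.1 hne
  obtain ⟨p⟩ := hG.preconnected x y
  -- If the zero set were proper and nonempty, some edge would leave it. At its zero end the
  -- eigenvalue equation makes a sum of nonnegative neighbour values vanish, although one of them is
  -- nonzero.
  obtain ⟨d, -, hd1, hd2⟩ := p.exists_boundary_dart {z | u z = 0} hx0 hy
  have h1 := congrFun h d.fst
  rw [SimpleGraph.adjMatrix_mulVec_apply, Pi.smul_apply, show u d.fst = 0 from hd1, smul_zero,
    Finset.sum_eq_zero_iff_of_nonneg fun z _ => h0 z] at h1
  exact hd2 (h1 d.snd (by simp))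

/-- The absolute value of an eigenvector for the largest eigenvalue is an eigenvector. -/
theorem adjMatrix_mulVec_abs {a : ℝ} (ha : ∀ t ∈ spectrum ℝ (G.adjMatrix ℝ), t ≤ a) {u : V → ℝ}
    (h : G.adjMatrix ℝ *ᵥ u = a • u) : G.adjMatrix ℝ *ᵥ |u| = a • |u| := by
  have hP := posSemidef_smul_one_sub (isHermitian_adjMatrix G) ha
  -- For a semidefinite matrix, a zero of the quadratic form lies in the kernel. The form at |u| is
  -- at most its value at u, which is 0, because A has nonnegative entries.
  have hz := (hP.dotProduct_mulVec_zero_iff |u|).1 ?_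
  · rw [sub_mulVec, smul_mulVec, one_mulVec, sub_eq_zero] at hz
    exact hz.symm
  · refine le_antisymm ?_ (hP.dotProduct_mulVec_nonneg _)
    have h1 : star |u| ⬝ᵥ (a • (1 : Matrix V V ℝ) - G.adjMatrix ℝ) *ᵥ |u| =
        u ⬝ᵥ (a • u) - |u| ⬝ᵥ G.adjMatrix ℝ *ᵥ |u| := by
      rw [sub_mulVec, smul_mulVec, one_mulVec, dotProduct_sub, star_trivial]
      congr 1
      simp [dotProduct, mul_left_comm]
    rw [h1, ← h, sub_nonpos]
    simp only [dotProduct, mulVec, Finset.mul_sum, Pi.abs_apply]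
    refine Finset.sum_le_sum fun x _ => Finset.sum_le_sum fun y _ => ?_
    refine (le_abs_self _).trans (le_of_eq ?_)
    rw [abs_mul, abs_mul, abs_of_nonneg (a := G.adjMatrix ℝ x y)]
    rw [SimpleGraph.adjMatrix_apply]
    split_ifs <;> simp

/-- This is the simplicity of the largest eigenvalue: a combination of two eigenvectors that cancels
at one vertex must be zero, so the two are proportional. -/
theorem eigenvector_ne_zero (hG : G.Connected) {a : ℝ}
    (ha : ∀ t ∈ spectrum ℝ (G.adjMatrix ℝ), t ≤ a) {u : V → ℝ} (hne : u ≠ 0)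
    (h : G.adjMatrix ℝ *ᵥ u = a • u) (x : V) : u x ≠ 0 := by
  have := pos_of_nonneg_eigenvector G hG (u := |u|) (fun x => abs_nonneg (u x))
    (by simpa using hne) (adjMatrix_mulVec_abs G ha h) x
  exact abs_pos.1 this

theorem exists_ne_zero_of_mem_spectrum {A : Matrix V V ℝ} {a : ℝ} (h : a ∈ spectrum ℝ A) :
    ∃ u : V → ℝ, u ≠ 0 ∧ A *ᵥ u = a • u := by
  rw [← Matrix.spectrum_toLin', ← Module.End.hasEigenvalue_iff_mem_spectrum] at h
  obtain ⟨u, hu⟩ := h.exists_hasEigenvector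
  exact ⟨u, hu.2, by simpa using hu.apply_eq_smul⟩

/-- For a graph in `𝒢₃(θ₀, θ₁, θ₂)` there is a positive vector `α` with
`(A - θ₁)(A - θ₂) = α αᵀ`. -/
theorem InG3With.exists_pos_vector {θ₀ θ₁ θ₂ : ℝ} (h : InG3With G θ₀ θ₁ θ₂) :
    ∃ α : V → ℝ, (∀ x, 0 < α x) ∧ ∀ x y, (G.adjMatrix ℝ * G.adjMatrix ℝ) x y =
      (θ₁ + θ₂) * G.adjMatrix ℝ x y - θ₁ * θ₂ * (1 : Matrix V V ℝ) x y + α x * α y := by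
  obtain ⟨hG, h10, h21, hs⟩ := h
  have ha : ∀ t ∈ spectrum ℝ (G.adjMatrix ℝ), t ≤ θ₀ := by
    rw [hs]
    rintro t (rfl | rfl | rfl)
    exacts [le_rfl, h10.le, (h21.trans h10).le]
  obtain ⟨u, hu0, hu⟩ := exists_ne_zero_of_mem_spectrum (A := G.adjMatrix ℝ) (a := θ₀)
    (by rw [hs]; simp)
  have hw := adjMatrix_mulVec_abs G ha hu
  have hwpos := pos_of_nonneg_eigenvector G hG (u := |u|) (fun x => abs_nonneg (u x))
    (by simpa using hu0) hw
  set w : V → ℝ := |u|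
  set A := G.adjMatrix ℝ with hAdef
  set P := (A - θ₁ • (1 : Matrix V V ℝ)) * (A - θ₂ • (1 : Matrix V V ℝ)) with hP
  have h0 := mul_mul_eq_zero_of_spectrum (isHermitian_adjMatrix G) hs
  rw [← hAdef, ← hP, sub_mul, sub_eq_zero, smul_mul_assoc, one_mul] at h0
  -- Each column of P is annihilated by A - θ₀, hence proportional to w.
  have hcol : ∀ x y z, w x * P z y = w z * P x y := by
    intro x y z
    by_contra hne
    have hv := eigenvector_ne_zero G hG ha (u := fun z => w x * P z y - P x y * w z) ?_ ?_ x
    · exact hv (by ring)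
    · exact Function.ne_iff.2 ⟨z, by simpa [sub_eq_zero, mul_comm (P x y)] using hne⟩
    · have e1 : A *ᵥ (fun z => P z y) = θ₀ • fun z => P z y := by
        ext z
        exact congrFun (congrFun h0 z) y
      have e2 : (fun z => w x * P z y - P x y * w z) = w x • (fun z => P z y) - P x y • w := rfl
      rw [← hAdef, e2, mulVec_sub, mulVec_smul, mulVec_smul, e1, hw]
      ext z
      simp only [Pi.sub_apply, Pi.smul_apply, smul_eq_mul]
      ring
  have hPexp : P = A * A - (θ₁ + θ₂) • A + (θ₁ * θ₂) • 1 := by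
    simp only [hP, sub_mul, mul_sub, smul_mul_assoc, mul_smul_comm, one_mul, mul_one]
    module
  have hsymm : ∀ x y, P x y = P y x := by
    have : Pᵀ = P := by
      rw [hPexp]
      simp [hAdef, transpose_mul]
    intro x y
    conv_lhs => rw [← this]
    rfl
  have hPw : P *ᵥ w = ((θ₀ - θ₁) * (θ₀ - θ₂)) • w := by
    rw [hP, ← mulVec_mulVec, sub_mulVec, sub_mulVec, smul_mulVec, smul_mulVec, one_mulVec,
      one_mulVec, hw, ← sub_smul, mulVec_smul, hw, smul_smul, smul_smul, ← sub_smul]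
    congr 1
    ring
  obtain ⟨o⟩ := hG.nonempty
  set c := P o o / (w o * w o) with hc
  have ho := (hwpos o).ne'
  have hPc : ∀ x y, P x y = c * w x * w y := by
    intro x y
    have e1 := hcol o y x
    have e2 := hcol o o y
    rw [hsymm o y] at e1
    rw [hc]
    field_simp
    linear_combination w o * e1 + w x * e2
  -- Apply P to w: its eigenvalue there is (θ₀ - θ₁)(θ₀ - θ₂) > 0.
  have hcpos : 0 < c := by
    have h1 := congrFun hPw o
    simp only [mulVec, dotProduct, hPc, Pi.smul_apply, smul_eq_mul] at h1
    have h2 : ∑ x, c * w o * w x * w x = c * (w o * ∑ x, w x * w x) := by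
      simp only [Finset.mul_sum]
      exact Finset.sum_congr rfl fun x _ => by ring
    rw [h2] at h1
    have h3 : 0 < w o * ∑ x, w x * w x :=
      mul_pos (hwpos o) (Finset.sum_pos (fun x _ => mul_pos (hwpos x) (hwpos x)) ⟨o, by simp⟩)
    have h4 : 0 < (θ₀ - θ₁) * (θ₀ - θ₂) * w o :=
      mul_pos (mul_pos (by linarith) (by linarith)) (hwpos o)
    rw [← h1] at h4
    exact pos_of_mul_pos_left h4 h3.le
  refine ⟨fun x => √c * w x, fun x => mul_pos (Real.sqrt_pos.2 hcpos) (hwpos x), fun x y => ?_⟩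
  have e := hPc x y
  rw [hPexp] at e
  simp only [Matrix.add_apply, Matrix.sub_apply, Matrix.smul_apply, smul_eq_mul] at e
  have e2 := Real.mul_self_sqrt hcpos.le
  linear_combination e - w x * w y * e2

theorem InG3.exists_inG3With {G : SimpleGraph V} [DecidableRel G.Adj] (h : InG3 G) :
    ∃ θ₀ θ₁ θ₂, InG3With G θ₀ θ₁ θ₂ := by
  obtain ⟨hG, hc⟩ := h
  have hf : (spectrum ℝ (G.adjMatrix ℝ)).Finite := Set.finite_of_ncard_ne_zero (by omega)
  set s := hf.toFinset
  have hs : s.card = 3 := by rw [← Set.ncard_eq_toFinset_card _ hf, hc]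
  let f := s.orderEmbOfFin hs
  refine ⟨f 2, f 1, f 0, hG, f.strictMono (by decide), f.strictMono (by decide), ?_⟩
  have h1 : (s : Set ℝ) = Set.range f := (s.range_orderEmbOfFin hs).symm
  rw [hf.coe_toFinset] at h1
  rw [h1]
  ext t
  simp only [Set.mem_range, Fin.exists_fin_succ, Set.mem_insert_iff, Set.mem_singleton_iff]
  simp [eq_comm]
  tauto

end spectral

/-! ### Block matrices of a quasi-symmetric design and its block graph -/

section blocks

variable {P B : Type*} [Fintype P] [DecidableEq P] [Fintype B] [DecidableEq B]

theorem allOnes_mulVec {m n : Type*} [Fintype n] (u : n → ℝ) (i : m) :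
    (allOnes m n ℝ *ᵥ u) i = ∑ j, u j := by
  simp [allOnes, mulVec, dotProduct]

/-- The equations between the blocks of a symmetric matrix
`[[ε (J - I), M], [Mᵀ, N]]` satisfying `A² = τ A - δ I + α αᵀ`, where `α` is constant on both parts,
`M` is the incidence matrix of a design with inner constants `lam`, `x`, `y`, and `N` encodes the
intersection numbers `x` and `y`. -/
structure IsDesignBlock (M : Matrix P B ℝ) (N : Matrix B B ℝ) (ε τ δ β γ a b lam x y : ℝ) :
    Prop where
  transpose_eq : Nᵀ = N
  block_point : ε • ((allOnes P P ℝ - 1) * M) + M * N = τ • M + γ • allOnes P B ℝ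
  block_block : Mᵀ * M + N * N = τ • N - δ • (1 : Matrix B B ℝ) + β • allOnes B B ℝ
  gram_points : M * Mᵀ = (b - lam) • (1 : Matrix P P ℝ) + lam • allOnes P P ℝ
  gram_blocks : Mᵀ * M = (a - y) • (1 : Matrix B B ℝ) + (x - y) • N + y • allOnes B B ℝ
  col_sum : ∀ j, ∑ p, M p j = a
  row_sum : ∀ p, ∑ j, M p j = b
  exists_ne : ∃ p j p' j', M p j ≠ M p' j'
  exists_ne' : ∃ i j k, k ≠ i ∧ k ≠ j ∧ N k i ≠ N k j
  size_ne : a ≠ 0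

namespace IsDesignBlock

variable {M : Matrix P B ℝ} {N : Matrix B B ℝ} {ε τ δ β γ a b lam x y : ℝ}
  (h : IsDesignBlock M N ε τ δ β γ a b lam x y)

include h

theorem allOnes_mul : allOnes P P ℝ * M = a • allOnes P B ℝ := by
  ext p j
  simpa [allOnes, mul_apply] using h.col_sum j

theorem mul_allOnes : M * allOnes B B ℝ = b • allOnes P B ℝ := by
  ext p j
  simpa [allOnes, mul_apply] using h.row_sum p

theorem mul_eq : M * N = (τ + ε) • M + (γ - ε * a) • allOnes P B ℝ := by
  have e := h.block_point
  rw [Matrix.sub_mul, Matrix.one_mul, h.allOnes_mul] at e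
  have : M * N = τ • M + γ • allOnes P B ℝ - ε • (a • allOnes P B ℝ - M) := by rw [← e]; abel
  rw [this]
  module

/-- Both identities come from (MMᵀ)M = M(MᵀM), expanded by the Gram equations and `mul_eq`.
Coefficients of M and J may be compared because M is not constant. -/
theorem coeff_eq : (x - y) * (τ + ε) = b - lam + y - a ∧
    (x - y) * (γ - ε * a) = lam * a - y * b := by
  have e : (M * Mᵀ) * M = M * (Mᵀ * M) := Matrix.mul_assoc _ _ _
  rw [h.gram_points, h.gram_blocks, Matrix.add_mul, Matrix.mul_add, Matrix.mul_add,
    Matrix.smul_mul, Matrix.one_mul, Matrix.smul_mul, Matrix.mul_smul, Matrix.mul_smul,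
    Matrix.mul_smul, Matrix.mul_one, h.allOnes_mul,
    h.mul_allOnes, h.mul_eq] at e
  have key : ∀ p j, ((x - y) * (τ + ε) - (b - lam + y - a)) * M p j +
      ((x - y) * (γ - ε * a) - (lam * a - y * b)) = 0 := by
    intro p j
    have := congrFun (congrFun e p) j
    simp only [Matrix.add_apply, Matrix.smul_apply, smul_eq_mul, allOnes, of_apply] at this
    linear_combination -this
  obtain ⟨p, j, p', j', hne⟩ := h.exists_ne
  have h1 : (x - y) * (τ + ε) - (b - lam + y - a) = 0 := by
    have : ((x - y) * (τ + ε) - (b - lam + y - a)) * (M p j - M p' j') = 0 := by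
      linear_combination key p j - key p' j'
    exact (mul_eq_zero.1 this).resolve_right (sub_ne_zero.2 hne)
  have h2 := key p j
  rw [h1, zero_mul, zero_add] at h2
  exact ⟨sub_eq_zero.1 h1, sub_eq_zero.1 h2⟩

theorem gram_mulVec {u : B → ℝ} (hu : ∑ j, u j = 0) :
    Mᵀ *ᵥ (M *ᵥ u) = (a - y) • u + (x - y) • (N *ᵥ u) := by
  rw [mulVec_mulVec, h.gram_blocks]
  ext j
  simp [add_mulVec, smul_mulVec, allOnes_mulVec, hu]

theorem sq_mulVec {u : B → ℝ} (hu : ∑ j, u j = 0) :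
    N *ᵥ (N *ᵥ u) = τ • (N *ᵥ u) - δ • u - Mᵀ *ᵥ (M *ᵥ u) := by
  rw [mulVec_mulVec, mulVec_mulVec, eq_sub_of_add_eq' h.block_block]
  ext j
  simp [add_mulVec, sub_mulVec, smul_mulVec, allOnes_mulVec, hu]

/-- If all rows of M agreed, the constant column sums would make M constant. -/
theorem exists_sub_single : ∃ i j : P, Mᵀ *ᵥ (Pi.single i 1 - Pi.single j 1) ≠ 0 ∧ i ≠ j := by
  by_contra! hc
  have hrow : ∀ (i j : P) (k : B), M i k = M j k := by
    intro i j k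
    by_contra hne
    have h0 : Mᵀ *ᵥ (Pi.single i 1 - Pi.single j 1) ≠ 0 := by
      refine Function.ne_iff.2 ⟨k, ?_⟩
      simpa [mulVec_sub, sub_eq_zero] using hne
    exact hne (by rw [hc i j h0])
  obtain ⟨p, j, p', j', hne⟩ := h.exists_ne
  have : ∀ k, (Fintype.card P : ℝ) * M p k = a := by
    intro k
    rw [← h.col_sum k, Finset.sum_congr rfl fun i _ => hrow i p k]
    simp
  have hP : (Fintype.card P : ℝ) ≠ 0 := Nat.cast_ne_zero.2 (Fintype.card_pos_iff.2 ⟨p⟩).ne'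
  rw [hrow p' p] at hne
  exact hne (mul_left_cancel₀ hP ((this j).trans (this j').symm))

/-- An eigenvector for the first restricted eigenvalue of the block graph. -/
theorem exists_eigenvector_add : ∃ u : B → ℝ, u ≠ 0 ∧ ∑ j, u j = 0 ∧ N *ᵥ u = (τ + ε) • u ∧
    Mᵀ *ᵥ (M *ᵥ u) = (b - lam) • u ∧ b ≠ lam := by
  obtain ⟨i, j, hne, hij⟩ := h.exists_sub_single
  set v : P → ℝ := Pi.single i 1 - Pi.single j 1 with hv
  have hv0 : ∑ p, v p = 0 := by simp [hv]
  have hsum : ∑ k, (Mᵀ *ᵥ v) k = 0 := by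
    simp only [mulVec, dotProduct, transpose_apply]
    rw [Finset.sum_comm]
    simp only [← Finset.sum_mul, h.row_sum, ← Finset.mul_sum, hv0, mul_zero]
  have hMv : M *ᵥ (Mᵀ *ᵥ v) = (b - lam) • v := by
    rw [mulVec_mulVec, h.gram_points]
    ext p
    simp [add_mulVec, smul_mulVec, allOnes_mulVec, hv0]
  refine ⟨Mᵀ *ᵥ v, hne, hsum, ?_, ?_, ?_⟩
  · have e : N * Mᵀ = (τ + ε) • Mᵀ + (γ - ε * a) • allOnes B P ℝ := by
      have := congrArg transpose h.mul_eq
      rw [transpose_mul, h.transpose_eq, transpose_add, transpose_smul, transpose_smul] at this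
      exact this
    rw [mulVec_mulVec, e]
    ext p
    simp [add_mulVec, smul_mulVec, allOnes_mulVec, hv0]
  · rw [hMv, mulVec_smul]
  · intro hb
    rw [hb, sub_self, zero_smul] at hMv
    -- The squared norm of Mᵀv equals v · MMᵀv.
    have : (Mᵀ *ᵥ v) ⬝ᵥ (Mᵀ *ᵥ v) = 0 := by
      rw [mulVec_transpose, ← dotProduct_mulVec, ← mulVec_transpose, hMv, dotProduct_zero]
    exact hne (dotProduct_self_eq_zero.1 this)

/-- On 1^⊥ the equation for MN reads M(N - (τ + ε)) = 0. Since every column of M has the nonzero sum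
a, the kernel of M lies in 1^⊥, so the argument can be iterated on the new vector. -/
theorem sub_mem_ker {u : B → ℝ} (hu : ∑ j, u j = 0) :
    ∑ j, (N *ᵥ u - (τ + ε) • u) j = 0 ∧ M *ᵥ (N *ᵥ u - (τ + ε) • u) = 0 := by
  have hM : M *ᵥ (N *ᵥ u - (τ + ε) • u) = 0 := by
    rw [mulVec_sub, mulVec_mulVec, h.mul_eq, mulVec_smul]
    ext j
    simp [add_mulVec, smul_mulVec, allOnes_mulVec, hu]
  refine ⟨?_, hM⟩
  have ha : (∑ p, ∑ j, M p j * (N *ᵥ u - (τ + ε) • u) j) = 0 :=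
    Finset.sum_eq_zero fun p _ => congrFun hM p
  rw [Finset.sum_comm] at ha
  simp only [← Finset.sum_mul, h.col_sum, ← Finset.mul_sum] at ha
  exact (mul_eq_zero.1 ha).resolve_left h.size_ne

/-- Guarantees that the second eigenvalue occurs: N acting as a scalar on 1^⊥ would have equal
off-diagonal entries in each row. -/
theorem exists_sub_ne_zero : ∃ u : B → ℝ, ∑ j, u j = 0 ∧ N *ᵥ u - (τ + ε) • u ≠ 0 := by
  obtain ⟨i, j, k, hki, hkj, hne⟩ := h.exists_ne'
  refine ⟨Pi.single i 1 - Pi.single j 1, by simp, Function.ne_iff.2 ⟨k, ?_⟩⟩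
  simpa [mulVec_sub, hki, hkj, sub_eq_zero] using hne

/-- If x = y, then MᵀM acts on 1^⊥ as the scalar a - y, which must be 0 because M has a nonzero
kernel vector there. The first identity of `coeff_eq` then gives b = lam, which is excluded. -/
theorem ne : x ≠ y := by
  intro hxy
  obtain ⟨u, hs, hu⟩ := h.exists_sub_ne_zero
  obtain ⟨h1, h2⟩ := h.sub_mem_ker hs
  obtain ⟨-, -, -, -, -, hb⟩ := h.exists_eigenvector_add
  have e := h.gram_mulVec h1
  have h3 := h.coeff_eq.1
  rw [hxy, sub_self, zero_mul] at h3
  rw [h2, mulVec_zero, hxy, sub_self, zero_smul, add_zero] at e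
  rcases smul_eq_zero.1 e.symm with h4 | h4
  · exact hb (by linarith)
  · exact hu h4

theorem ker_eigenvector {w : B → ℝ} (hw : ∑ j, w j = 0) (hM : M *ᵥ w = 0) :
    N *ᵥ w = ((y - a) / (x - y)) • w := by
  have hxy : x - y ≠ 0 := sub_ne_zero.2 h.ne
  have e := h.gram_mulVec hw
  rw [hM, mulVec_zero] at e
  ext j
  have := congrFun e j
  simp only [Pi.zero_apply, Pi.add_apply, Pi.smul_apply, smul_eq_mul] at this ⊢
  field_simp
  linear_combination -this

theorem eigenvalue_ne : τ + ε ≠ (y - a) / (x - y) := by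
  have hxy : x - y ≠ 0 := sub_ne_zero.2 h.ne
  obtain ⟨-, -, -, -, -, hb⟩ := h.exists_eigenvector_add
  rw [ne_eq, eq_div_iff hxy, mul_comm, h.coeff_eq.1]
  intro e
  exact hb (by linarith)

/-- The restricted eigenvalues of the block graph. -/
theorem restricted_eq :
    {e | ∃ u : B → ℝ, u ≠ 0 ∧ ∑ j, u j = 0 ∧ N *ᵥ u = e • u} = {τ + ε, (y - a) / (x - y)} := by
  ext g
  constructor
  · rintro ⟨u, hu, hs, hg⟩
    obtain ⟨h1, h2⟩ := h.sub_mem_ker hs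
    have h3 := h.ker_eigenvector h1 h2
    rw [hg, ← sub_smul, mulVec_smul, hg, smul_smul, smul_smul, ← sub_eq_zero, ← sub_smul,
      smul_eq_zero] at h3
    have h4 := h3.resolve_right hu
    rw [mul_comm, ← sub_mul, mul_eq_zero, sub_eq_zero, sub_eq_zero] at h4
    exact h4.symm
  · rintro (rfl | rfl)
    · obtain ⟨u, hu, hs, he, -⟩ := h.exists_eigenvector_add
      exact ⟨u, hu, hs, he⟩
    · obtain ⟨u, hs, hu⟩ := h.exists_sub_ne_zero
      obtain ⟨h1, h2⟩ := h.sub_mem_ker hs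
      exact ⟨_, hu, h1, h.ker_eigenvector h1 h2⟩

/-- The eigenvalue `(y - a) / (x - y)` is an eigenvalue of the whole matrix. -/
theorem ker_eigenvalue_sq :
    ((y - a) / (x - y)) ^ 2 = τ * ((y - a) / (x - y)) - δ := by
  obtain ⟨u, hs, hu⟩ := h.exists_sub_ne_zero
  obtain ⟨h1, h2⟩ := h.sub_mem_ker hs
  set w := N *ᵥ u - (τ + ε) • u
  have h3 := h.ker_eigenvector h1 h2
  have h4 := h.sq_mulVec h1
  rw [h2, mulVec_zero, h3, mulVec_smul, h3, sub_zero] at h4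
  set e := (y - a) / (x - y)
  have h5 : (e ^ 2 - (τ * e - δ)) • w = 0 := by
    linear_combination (norm := module) h4
  exact sub_eq_zero.1 ((smul_eq_zero.1 h5).resolve_right hu)

/-- Evaluate the equation for N² on Mᵀv, where N acts as τ + ε and MᵀM as b - lam. With τ = θ₁ + θ₂
and δ = θ₁θ₂ the right side is (θ₁ + ε)(θ₂ + ε). -/
theorem sub_eq_add : lam - b = δ + ε * (τ + ε) := by
  obtain ⟨u, hu, hs, h3, h4, -⟩ := h.exists_eigenvector_add
  have h5 := h.sq_mulVec hs
  rw [h4, h3, mulVec_smul, h3] at h5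
  have h6 : ((lam - b) - (δ + ε * (τ + ε))) • u = 0 := by
    linear_combination (norm := module) -h5
  exact sub_eq_zero.1 ((smul_eq_zero.1 h6).resolve_right hu)

/-- The coefficients of the quadratic polynomial of the restricted eigenvalues. -/
theorem vieta : (τ + ε) + (y - a) / (x - y) = τ - (x - y) ∧
    (τ + ε) * ((y - a) / (x - y)) = δ + a - y := by
  have hxy : x - y ≠ 0 := sub_ne_zero.2 h.ne
  have h1 := h.coeff_eq.1
  have h2 := h.ker_eigenvalue_sq
  have h3 := h.sub_eq_add
  have h4 := sub_ne_zero.2 h.eigenvalue_ne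
  have h5 : (y - a) / (x - y) * (x - y) = y - a := div_mul_cancel₀ _ hxy
  generalize (y - a) / (x - y) = e at *
  have h6 : (τ + ε) + e = τ - (x - y) := by
    -- Both eigenvalues are roots of t² - (τ - (x - y))t + (δ + a - y); subtract the two equations
    -- and cancel the nonzero difference of the roots.
    apply mul_left_cancel₀ h4
    linear_combination -h2 - h5 + h1 - h3
  refine ⟨h6, ?_⟩
  linear_combination e * h6 - h2 - h5

end IsDesignBlock

end blocks

/-! ### An upper bound for the coherent closure -/

section closure

variable {V : Type*} [Fintype V] [DecidableEq V] (G : SimpleGraph V) [DecidableRel G.Adj]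

/-- The matrices that are linear combinations of `I`, `A` and `J` on each block of the
partition `ψ`. -/
def IsBlockCombination (ψ : V → Bool) (M : Matrix V V ℂ) : Prop :=
  ∃ p q r : Bool → Bool → ℂ, ∀ x y, M x y = p (ψ x) (ψ y) * (1 : Matrix V V ℂ) x y +
    q (ψ x) (ψ y) * G.adjMatrix ℂ x y + r (ψ x) (ψ y)

variable {G} {ψ : V → Bool} {τ δ : ℂ} {γ d : Bool → Bool → ℂ} {σ : Bool → Bool} {s t : Bool → ℂ}

theorem adjMatrix_comm {W : Type*} {G : SimpleGraph W} [DecidableRel G.Adj] (x y : W) : G.adjMatrix ℂ x y = G.adjMatrix ℂ y x := by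
  simp [SimpleGraph.adjMatrix_apply, G.adj_comm]

/-- Here σ selects, for each cell, the cell that it meets in a flat block. Paths through that cell
are counted by substituting the flat form; paths through the other cell are the rest of A². -/
theorem exists_block_path_count
    (hd : ∀ x j, (∑ z, if ψ z = j then G.adjMatrix ℂ x z else 0) = d (ψ x) j)
    (hsq : ∀ x y, ∑ z, G.adjMatrix ℂ x z * G.adjMatrix ℂ z y =
      τ * G.adjMatrix ℂ x y - δ * (1 : Matrix V V ℂ) x y + γ (ψ x) (ψ y))
    (hflat : ∀ x z, ψ z = σ (ψ x) → G.adjMatrix ℂ x z = s (ψ x) + t (ψ x) * (1 : Matrix V V ℂ) x z) :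
    ∃ p q r : Bool → Bool → Bool → ℂ, ∀ j x y,
      (∑ z, if ψ z = j then G.adjMatrix ℂ x z * G.adjMatrix ℂ z y else 0) =
        p j (ψ x) (ψ y) * (1 : Matrix V V ℂ) x y + q j (ψ x) (ψ y) * G.adjMatrix ℂ x y +
          r j (ψ x) (ψ y) := by
  have h1 : ∀ x y, (∑ z, if ψ z = σ (ψ x) then G.adjMatrix ℂ x z * G.adjMatrix ℂ z y else 0) =
      (if σ (ψ x) = ψ x then t (ψ x) else 0) * G.adjMatrix ℂ x y +
        s (ψ x) * d (ψ y) (σ (ψ x)) := by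
    intro x y
    rw [← hd, Finset.mul_sum]
    have e : ∀ z, (if ψ z = σ (ψ x) then G.adjMatrix ℂ x z * G.adjMatrix ℂ z y else 0) =
        (if x = z then (if ψ z = σ (ψ x) then t (ψ x) else 0) * G.adjMatrix ℂ z y else 0) +
        s (ψ x) * (if ψ z = σ (ψ x) then G.adjMatrix ℂ y z else 0) := by
      intro z
      by_cases hz : ψ z = σ (ψ x)
      · rw [if_pos hz, if_pos hz, if_pos hz, hflat x z hz, adjMatrix_comm y z, one_apply]
        split_ifs <;> ring
      · simp [hz]
    rw [Finset.sum_congr rfl fun z _ => e z, Finset.sum_add_distrib]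
    simp [eq_comm]
  have h2 : ∀ x y, (∑ z, if ψ z = !σ (ψ x) then G.adjMatrix ℂ x z * G.adjMatrix ℂ z y else 0) =
      τ * G.adjMatrix ℂ x y - δ * (1 : Matrix V V ℂ) x y + γ (ψ x) (ψ y) -
        ((if σ (ψ x) = ψ x then t (ψ x) else 0) * G.adjMatrix ℂ x y +
          s (ψ x) * d (ψ y) (σ (ψ x))) := by
    intro x y
    rw [← hsq, ← h1, ← Finset.sum_sub_distrib]
    refine Finset.sum_congr rfl fun z _ => ?_
    cases ψ z <;> cases σ (ψ x) <;> simp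
  refine ⟨fun j i k => if j = σ i then 0 else -δ,
    fun j i k => if j = σ i then (if σ i = i then t i else 0) else
      τ - (if σ i = i then t i else 0),
    fun j i k => if j = σ i then s i * d k (σ i) else γ i k - s i * d k (σ i), ?_⟩
  intro j x y
  by_cases hj : j = σ (ψ x)
  · subst hj
    simp only [if_true]
    rw [h1]
    ring
  · simp only [if_neg hj]
    have : j = !σ (ψ x) := by
      revert hj
      cases j <;> cases σ (ψ x) <;> simp
    rw [this, h2]
    ring

theorem IsBlockCombination.mul {M N : Matrix V V ℂ} {P Q R : Bool → Bool → Bool → ℂ}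
    (hd : ∀ x j, (∑ z, if ψ z = j then G.adjMatrix ℂ x z else 0) = d (ψ x) j)
    (hB : ∀ j x y, (∑ z, if ψ z = j then G.adjMatrix ℂ x z * G.adjMatrix ℂ z y else 0) =
        P j (ψ x) (ψ y) * (1 : Matrix V V ℂ) x y + Q j (ψ x) (ψ y) * G.adjMatrix ℂ x y +
          R j (ψ x) (ψ y))
    (hM : IsBlockCombination G ψ M) (hN : IsBlockCombination G ψ N) :
    IsBlockCombination G ψ (M * N) := by
  obtain ⟨p, q, r, hM⟩ := hM
  obtain ⟨p', q', r', hN⟩ := hN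
  have hd' : ∀ y j, (∑ z, if ψ z = j then G.adjMatrix ℂ z y else 0) = d (ψ y) j := by
    intro y j
    simp only [adjMatrix_comm _ y, hd]
  have key : ∀ j x y, (∑ z, if ψ z = j then M x z * N z y else 0) =
      ((if ψ x = j then p (ψ x) j * p' j (ψ y) else 0) + q (ψ x) j * q' j (ψ y) * P j (ψ x) (ψ y))
          * (1 : Matrix V V ℂ) x y +
        ((if ψ x = j then p (ψ x) j * q' j (ψ y) else 0) +
          (if ψ y = j then q (ψ x) j * p' j (ψ y) else 0) +
          q (ψ x) j * q' j (ψ y) * Q j (ψ x) (ψ y)) * G.adjMatrix ℂ x y +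
        ((if ψ x = j then p (ψ x) j * r' j (ψ y) else 0) +
          (if ψ y = j then r (ψ x) j * p' j (ψ y) else 0) +
          q (ψ x) j * q' j (ψ y) * R j (ψ x) (ψ y) + q (ψ x) j * r' j (ψ y) * d (ψ x) j +
          r (ψ x) j * q' j (ψ y) * d (ψ y) j +
          r (ψ x) j * r' j (ψ y) * ∑ z, if ψ z = j then 1 else 0) := by
    intro j x y
    have e : ∀ z, (if ψ z = j then M x z * N z y else 0) =
        (if x = z then (if ψ z = j then p (ψ x) j * (p' j (ψ y) * (1 : Matrix V V ℂ) z y +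
          q' j (ψ y) * G.adjMatrix ℂ z y + r' j (ψ y)) else 0) else 0) +
        (if z = y then (if ψ z = j then (q (ψ x) j * G.adjMatrix ℂ x z + r (ψ x) j) * p' j (ψ y)
          else 0) else 0) +
        q (ψ x) j * q' j (ψ y) * (if ψ z = j then G.adjMatrix ℂ x z * G.adjMatrix ℂ z y else 0) +
        q (ψ x) j * r' j (ψ y) * (if ψ z = j then G.adjMatrix ℂ x z else 0) +
        r (ψ x) j * q' j (ψ y) * (if ψ z = j then G.adjMatrix ℂ z y else 0) +
        r (ψ x) j * r' j (ψ y) * (if ψ z = j then 1 else 0) := by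
      intro z
      by_cases hz : ψ z = j
      · subst hz
        simp only [if_true, hM, hN, one_apply]
        split_ifs <;> ring
      · simp [hz]
    rw [Finset.sum_congr rfl fun z _ => e z]
    simp only [Finset.sum_add_distrib, ← Finset.mul_sum, hd, hd', hB]
    simp only [Finset.sum_ite_eq, Finset.sum_ite_eq', Finset.mem_univ, if_true]
    split_ifs <;> ring
  refine ⟨fun i k => ∑ j, ((if i = j then p i j * p' j k else 0) + q i j * q' j k * P j i k),
    fun i k => ∑ j, ((if i = j then p i j * q' j k else 0) +
          (if k = j then q i j * p' j k else 0) + q i j * q' j k * Q j i k),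
    fun i k => ∑ j, ((if i = j then p i j * r' j k else 0) +
          (if k = j then r i j * p' j k else 0) +
          q i j * q' j k * R j i k + q i j * r' j k * d i j + r i j * q' j k * d k j +
          r i j * r' j k * ∑ z, if ψ z = j then 1 else 0), ?_⟩
  intro x y
  simp only [Finset.sum_mul]
  rw [← Finset.sum_add_distrib, ← Finset.sum_add_distrib, ← Finset.sum_congr rfl fun j _ => key j x y,
    Finset.sum_comm, mul_apply]
  exact Finset.sum_congr rfl fun z _ => by simp

/-- If every block of the partition `ψ` satisfies the stated regularity conditions, the coherent
closure consists of blockwise combinations of `I`, `A` and `J`. -/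
theorem isBlockCombination_of_mem_coherentClosure
    (hd : ∀ x j, (∑ z, if ψ z = j then G.adjMatrix ℂ x z else 0) = d (ψ x) j)
    (hsq : ∀ x y, ∑ z, G.adjMatrix ℂ x z * G.adjMatrix ℂ z y =
      τ * G.adjMatrix ℂ x y - δ * (1 : Matrix V V ℂ) x y + γ (ψ x) (ψ y))
    (hflat : ∀ x z, ψ z = σ (ψ x) → G.adjMatrix ℂ x z = s (ψ x) + t (ψ x) * (1 : Matrix V V ℂ) x z)
    {M : Matrix V V ℂ} (hM : M ∈ coherentClosure G) : IsBlockCombination G ψ M := by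
  obtain ⟨P, Q, R, hB⟩ := exists_block_path_count hd hsq hflat
  let T : Subalgebra ℂ (Matrix V V ℂ) :=
    { carrier := {M | IsBlockCombination G ψ M}
      mul_mem' := fun hM hN => hM.mul hd hB hN
      add_mem' := by
        rintro M N ⟨p, q, r, h⟩ ⟨p', q', r', h'⟩
        refine ⟨p + p', q + q', r + r', fun x y => ?_⟩
        simp only [Matrix.add_apply, h, h', Pi.add_apply]
        ring
      algebraMap_mem' := by
        intro c
        refine ⟨fun _ _ => c, 0, 0, fun x y => ?_⟩
        simp [Algebra.algebraMap_eq_smul_one] }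
  have hT : IsCoherent T := by
    refine ⟨⟨0, 0, 1, fun x y => by simp [allOnes]⟩, ?_, ?_⟩
    · rintro M ⟨p, q, r, h⟩
      refine ⟨fun i k => p k i, fun i k => q k i, fun i k => r k i, fun x y => ?_⟩
      rw [transpose_apply, h, adjMatrix_comm, one_apply, one_apply]
      simp only [eq_comm]
    · rintro M ⟨p, q, r, h⟩ N ⟨p', q', r', h'⟩
      -- Entrywise, I and A are orthogonal idempotents and J is the identity.
      refine ⟨p * p' + p * r' + r * p', q * q' + q * r' + r * q', r * r', fun x y => ?_⟩
      simp only [hadamard_apply, h, h', Pi.add_apply, Pi.mul_apply, one_apply]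
      by_cases hxy : x = y
      · subst hxy
        simp
        ring
      · by_cases ha : G.Adj x y
        · simp [hxy, ha]
          ring
        · simp [hxy, ha]
  have hA : G.adjMatrix ℂ ∈ T := ⟨0, 1, 0, fun x y => by simp⟩
  exact Algebra.mem_sInf.1 hM T ⟨hT, hA⟩

theorem relationThrough_eq_iff {S : Subalgebra ℂ (Matrix V V ℂ)} {p q : V × V} :
    relationThrough S p = relationThrough S q ↔ ∀ M ∈ S, M p.1 p.2 = M q.1 q.2 := by
  constructor
  · intro h M hM
    have : p ∈ relationThrough S q := h ▸ fun M _ => rfl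
    exact this M hM
  · intro h
    ext z
    exact ⟨fun hz M hM => (hz M hM).trans (h M hM), fun hz M hM => (hz M hM).trans (h M hM).symm⟩

theorem relationThrough_eq_of_block
    (h : ∀ M ∈ coherentClosure G, IsBlockCombination G ψ M) {p q : V × V}
    (h1 : ψ p.1 = ψ q.1) (h2 : ψ p.2 = ψ q.2) (h3 : p.1 = p.2 ↔ q.1 = q.2)
    (h4 : G.Adj p.1 p.2 ↔ G.Adj q.1 q.2) :
    relationThrough (coherentClosure G) p = relationThrough (coherentClosure G) q := by
  refine relationThrough_eq_iff.2 fun M hM => ?_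
  obtain ⟨a, b, c, hM⟩ := h M hM
  simp only [hM, h1, h2, SimpleGraph.adjMatrix_apply, h4, one_apply, h3]

end closure

/-! ### Fibres and numbers of relations -/

section fibres

variable {V : Type*} [Fintype V] [DecidableEq V] {S : Subalgebra ℂ (Matrix V V ℂ)}

open Classical in
-- Multiplying by these diagonal matrices restricts rows, columns or summation indices to one fibre
-- without leaving S.
theorem fibreMatrix_mem (hS : IsCoherent S) (w : V) :
    diagonal (fun u => if relationThrough S (u, u) = relationThrough S (w, w) then (1 : ℂ) else 0)
      ∈ S := by
  convert relationMatrix_mem hS (R := relationThrough S (w, w)) ⟨_, rfl⟩ using 1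
  ext u v
  simp only [relationMatrix, of_apply]
  by_cases huv : u = v
  · subst huv
    rw [diagonal_apply_eq]
    refine if_congr (Iff.trans ⟨fun h => ?_, fun h => ?_⟩ Iff.rfl) rfl rfl
    · rw [← h]
      exact fun M _ => rfl
    · exact relationThrough_eq_iff.2 h
  · rw [diagonal_apply_ne _ huv, if_neg]
    intro h
    simpa [huv] using h 1 (one_mem S)

theorem relationThrough_swap (hS : IsCoherent S) {x y x' y' : V}
    (h : relationThrough S (x, y) = relationThrough S (x', y')) :
    relationThrough S (y, x) = relationThrough S (y', x') :=
  relationThrough_eq_iff.2 fun M hM => relationThrough_eq_iff.1 h _ (hS.transpose_mem M hM)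

/-- If D is the diagonal matrix of a fibre, then DJ records whether the row index lies in that
fibre, and its entries are constant on relations. -/
theorem fibre_fst_eq (hS : IsCoherent S) {x y x' y' : V}
    (h : relationThrough S (x, y) = relationThrough S (x', y')) :
    relationThrough S (x, x) = relationThrough S (x', x') := by
  classical
  have := relationThrough_eq_iff.1 h _ (S.mul_mem (fibreMatrix_mem hS x) hS.allOnes_mem)
  by_contra hne
  simp [diagonal_mul, allOnes, Ne.symm hne] at this

theorem fibre_snd_eq (hS : IsCoherent S) {x y x' y' : V}
    (h : relationThrough S (x, y) = relationThrough S (x', y')) :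
    relationThrough S (y, y) = relationThrough S (y', y') :=
  fibre_fst_eq hS (relationThrough_swap hS h)

theorem eq_iff_of_relationThrough_eq {x y x' y' : V}
    (h : relationThrough S (x, y) = relationThrough S (x', y')) : x = y ↔ x' = y' := by
  have := relationThrough_eq_iff.1 h 1 (one_mem S)
  simp only [one_apply] at this
  split_ifs at this <;> simp_all

open Classical in
/-- Entries of `M D N`, with `D` the diagonal matrix of a fibre, are constant on relations. -/
theorem sum_fibre_eq (hS : IsCoherent S) {M N : Matrix V V ℂ} (hM : M ∈ S) (hN : N ∈ S) (w : V)
    {x y x' y' : V} (h : relationThrough S (x, y) = relationThrough S (x', y')) :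
    (∑ z, if relationThrough S (z, z) = relationThrough S (w, w) then M x z * N z y else 0) =
      ∑ z, if relationThrough S (z, z) = relationThrough S (w, w) then M x' z * N z y' else 0 := by
  have := relationThrough_eq_iff.1 h _ (S.mul_mem (S.mul_mem hM (fibreMatrix_mem hS w)) hN)
  rw [mul_apply, mul_apply] at this
  simpa [mul_diagonal, ite_mul] using this

open Classical in
/-- The number of relations meeting `X × Y`. -/
noncomputable def relationCount (S : Subalgebra ℂ (Matrix V V ℂ)) (X Y : Finset V) : ℕ :=
  ((X ×ˢ Y).image (relationThrough S)).card

theorem relationCount_comm (hS : IsCoherent S) (X Y : Finset V) :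
    relationCount S X Y = relationCount S Y X := by
  classical
  have key : ∀ X Y : Finset V, relationCount S X Y ≤ relationCount S Y X := by
    intro X Y
    refine Finset.card_le_card_of_surjOn (fun R => {p | p.swap ∈ R}) ?_
    intro R hR
    simp only [Finset.coe_image, Set.mem_image, Finset.mem_coe, Finset.mem_product] at hR ⊢
    obtain ⟨⟨x, y⟩, hxy, rfl⟩ := hR
    refine ⟨_, ⟨(y, x), ⟨hxy.2, hxy.1⟩, rfl⟩, ?_⟩
    ext ⟨u, v⟩
    exact ⟨fun h M hM => h _ (hS.transpose_mem M hM), fun h M hM => h _ (hS.transpose_mem M hM)⟩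
  exact le_antisymm (key X Y) (key Y X)

theorem relationCount_pos {X Y : Finset V} (hX : X.Nonempty) (hY : Y.Nonempty) :
    0 < relationCount S X Y := by
  classical
  exact Finset.card_pos.2 ((hX.product hY).image _)

theorem relationCount_le {κ : Type*} [Fintype κ] {X Y : Finset V} (c : V × V → κ)
    (h : ∀ p ∈ X ×ˢ Y, ∀ q ∈ X ×ˢ Y, c p = c q → relationThrough S p = relationThrough S q) :
    relationCount S X Y ≤ Fintype.card κ := by
  classical
  set g : κ → Set (V × V) := fun k =>
    if hk : ∃ p ∈ X ×ˢ Y, c p = k then relationThrough S hk.choose else ∅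
  refine Finset.card_le_card_of_surjOn (s := Finset.univ) g ?_
  intro R hR
  obtain ⟨p, hp, rfl⟩ := Finset.mem_image.1 hR
  have hk : ∃ q ∈ X ×ˢ Y, c q = c p := ⟨p, hp, rfl⟩
  refine ⟨c p, by simp, ?_⟩
  simp only [g, dif_pos hk]
  exact h _ hk.choose_spec.1 _ hp hk.choose_spec.2

theorem rank_eq_relationCount : rank S = relationCount S Finset.univ Finset.univ := by
  classical
  rw [rank, relationCount, basicRelations, ← Set.ncard_coe_finset]
  simp

theorem rank_eq_of_partition (hS : IsCoherent S) {X Y : Finset V} (hun : ∀ x, x ∈ X ∨ x ∈ Y)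
    (hne : ∀ x ∈ X, ∀ y ∈ Y, relationThrough S (x, x) ≠ relationThrough S (y, y)) :
    rank S = relationCount S X X + 2 * relationCount S X Y + relationCount S Y Y := by
  classical
  have hu : (Finset.univ : Finset V) = X ∪ Y := by
    ext x
    simpa using hun x
  have hd : ∀ {A B C D : Finset V}, (∀ x ∈ A, ∀ y ∈ B, ∀ x' ∈ C, ∀ y' ∈ D,
      relationThrough S (x, y) ≠ relationThrough S (x', y')) →
      Disjoint ((A ×ˢ B).image (relationThrough S)) ((C ×ˢ D).image (relationThrough S)) := by
    intro A B C D h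
    rw [Finset.disjoint_left]
    intro R h1 h2
    obtain ⟨⟨x, y⟩, hp, rfl⟩ := Finset.mem_image.1 h1
    obtain ⟨⟨x', y'⟩, hq, he⟩ := Finset.mem_image.1 h2
    rw [Finset.mem_product] at hp hq
    exact h x hp.1 y hp.2 x' hq.1 y' hq.2 he.symm
  rw [rank_eq_relationCount, two_mul]
  nth_rw 3 [relationCount_comm hS]
  simp only [relationCount]
  rw [hu, Finset.union_product, Finset.product_union, Finset.product_union, Finset.image_union,
    Finset.image_union, Finset.image_union, Finset.card_union_of_disjoint,
    Finset.card_union_of_disjoint, Finset.card_union_of_disjoint]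
  · ring
  · exact hd fun x hx y hy x' hx' y' hy' he => hne _ hy _ hy' (fibre_snd_eq hS he) |>.elim
  · exact hd fun x hx y hy x' hx' y' hy' he => hne _ hy _ hy' (fibre_snd_eq hS he) |>.elim
  · rw [Finset.disjoint_union_left, Finset.disjoint_union_right, Finset.disjoint_union_right]
    refine ⟨⟨?_, ?_⟩, ?_, ?_⟩ <;>
    exact hd fun x hx y hy x' hx' y' hy' he => hne _ hx _ hx' (fibre_fst_eq hS he) |>.elim

theorem exists_card_le_of_relationCount {X : Finset V} {x y : V} (hx : x ∈ X) (hy : y ∈ X)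
    (hxy : x ≠ y) : 2 ≤ relationCount S X X := by
  classical
  refine Finset.one_lt_card.2 ⟨relationThrough S (x, x),
    Finset.mem_image_of_mem _ (by simp [hx]), relationThrough S (x, y),
    Finset.mem_image_of_mem _ (by simp [hx, hy]), fun h => ?_⟩
  exact hxy ((eq_iff_of_relationThrough_eq h).1 rfl)

/-- A fibre with one element meets every fibre in a single relation. -/
theorem relationCount_eq_one (hS : IsCoherent S) {a : V} {Y : Finset V} (hY : Y.Nonempty)
    (ha : ∀ x, relationThrough S (x, x) = relationThrough S (a, a) → x = a)
    (hYf : ∀ y ∈ Y, ∀ y' ∈ Y, relationThrough S (y, y) = relationThrough S (y', y')) :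
    relationCount S {a} Y = 1 := by
  classical
  refine le_antisymm ((relationCount_le (κ := Unit) (fun _ => ()) ?_).trans (by simp))
    (relationCount_pos (by simp) hY)
  rintro ⟨x, y⟩ hp ⟨x', y'⟩ hq -
  simp only [Finset.mem_product, Finset.mem_singleton] at hp hq
  obtain ⟨rfl, hy⟩ := hp
  obtain ⟨rfl, hy'⟩ := hq
  refine relationThrough_eq_iff.2 fun M hM => ?_
  -- With D supported on the singleton fibre, the diagonal entry of JDM at y is just M x' y, so it
  -- is constant for y in a fibre.
  have := sum_fibre_eq hS hS.allOnes_mem hM x' (hYf y hy y' hy')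
  have e : ∀ z, relationThrough S (z, z) = relationThrough S (x', x') ↔ z = x' :=
    fun z => ⟨ha z, fun h => by rw [h]⟩
  simpa [e, allOnes] using this

/-- If a coherent algebra has rank nine and three fibres, then there are only three points. -/
theorem surjective_of_rank (hS : IsCoherent S) (hr : rank S = 9) {f : Fin 3 → V}
    (hf : Function.Injective fun i => relationThrough S (f i, f i)) (v : V) : ∃ i, f i = v := by
  classical
  set g : Fin 3 × Fin 3 → Set (V × V) := fun p => relationThrough S (f p.1, f p.2)
  have hg : Function.Injective g := fun p q h =>
    Prod.ext (hf (fibre_fst_eq hS h)) (hf (fibre_snd_eq hS h))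
  have hsub : Finset.univ.image g ⊆ (Finset.univ ×ˢ Finset.univ).image (relationThrough S) := by
    intro R hR
    obtain ⟨p, -, rfl⟩ := Finset.mem_image.1 hR
    exact Finset.mem_image_of_mem _ (by simp)
  -- The three representatives give nine different relations, hence all of them.
  have heq := Finset.eq_of_subset_of_card_le hsub (by
    rw [Finset.card_image_of_injective _ hg]
    rw [rank_eq_relationCount, relationCount] at hr
    rw [hr]
    simp)
  have hall : ∀ x y, ∃ i j, relationThrough S (f i, f j) = relationThrough S (x, y) := by
    intro x y
    have : relationThrough S (x, y) ∈ Finset.univ.image g := by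
      rw [heq]
      exact Finset.mem_image_of_mem _ (by simp)
    obtain ⟨p, -, hp⟩ := Finset.mem_image.1 this
    exact ⟨p.1, p.2, hp⟩
  obtain ⟨i, j, hij⟩ := hall v v
  obtain ⟨k, l, hkl⟩ := hall v (f i)
  -- The relation of (v, f i) has both ends in the fibre of f i, so it must be that of (f i, f i),
  -- which lies in the identity.
  have hki : k = i := hf ((fibre_fst_eq hS hkl).trans (fibre_fst_eq hS hij).symm)
  have hli : l = i := hf (fibre_snd_eq hS hkl)
  rw [hki, hli] at hkl
  exact ⟨i, ((eq_iff_of_relationThrough_eq hkl).1 rfl).symm⟩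

end fibres

/-! ### Automorphisms, and exclusion of three fibres. -/

section graph

variable {V : Type*} [Fintype V] [DecidableEq V] {G : SimpleGraph V} [DecidableRel G.Adj]

theorem adj_iff_of_relationThrough_eq {x y x' y' : V}
    (h : relationThrough (coherentClosure G) (x, y) = relationThrough (coherentClosure G) (x', y')) :
    G.Adj x y ↔ G.Adj x' y' := by
  have := relationThrough_eq_iff.1 h _ (adjMatrix_mem_coherentClosure G)
  simp only [SimpleGraph.adjMatrix_apply] at this
  split_ifs at this <;> simp_all

/-- Automorphisms of a graph preserve the relations of its coherent closure. -/
theorem relationThrough_map (σ : Equiv.Perm V) (hσ : ∀ x y, G.Adj (σ x) (σ y) ↔ G.Adj x y)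
    (x y : V) : relationThrough (coherentClosure G) (σ x, σ y) =
      relationThrough (coherentClosure G) (x, y) := by
  let T : Subalgebra ℂ (Matrix V V ℂ) :=
    { carrier := {M | ∀ x y, M (σ x) (σ y) = M x y}
      mul_mem' := by
        intro M N hM hN x y
        rw [mul_apply, mul_apply, ← Equiv.sum_comp σ]
        exact Finset.sum_congr rfl fun z _ => by rw [hM, hN]
      add_mem' := by
        intro M N hM hN x y
        rw [Matrix.add_apply, Matrix.add_apply, hM, hN]
      algebraMap_mem' := by
        intro c x y
        simp [algebraMap_matrix_apply] }
  have hT : IsCoherent T := by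
    refine ⟨fun x y => rfl, fun M hM x y => hM y x, fun M hM N hN x y => ?_⟩
    rw [hadamard_apply, hadamard_apply, hM, hN]
  have hA : G.adjMatrix ℂ ∈ T := fun x y => by simp [SimpleGraph.adjMatrix_apply, hσ]
  exact relationThrough_eq_iff.2 fun M hM => Algebra.mem_sInf.1 hM T ⟨hT, hA⟩ x y

/-- The coherent closure of a connected graph does not consist of all matrices of size three. -/
theorem not_three_fibres (hG : G.Connected) {f : Fin 3 → V}
    (hf : Function.Injective fun i => relationThrough (coherentClosure G) (f i, f i))
    (hsurj : ∀ v, ∃ i, f i = v) : False := by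
  have hinj : Function.Injective f := fun i j h => hf (by simp only [h])
  -- Two vertices with the remaining vertex as common neighbour are exchanged by an automorphism, so
  -- they lie in one fibre. Connectedness always provides such a pair.
  have hswap : ∀ i j k : Fin 3, i ≠ j → (∀ l, l = i ∨ l = j ∨ l = k) → G.Adj (f k) (f i) →
      G.Adj (f k) (f j) → False := by
    intro i j k hij hl hi hj
    have hki : f k ≠ f i := hi.ne
    have hkj : f k ≠ f j := hj.ne
    have h1 := relationThrough_map (G := G) (Equiv.swap (f i) (f j)) ?_ (f i) (f i)
    · rw [Equiv.swap_apply_left] at h1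
      exact hij (hf h1.symm)
    · intro x y
      obtain ⟨m, rfl⟩ := hsurj x
      obtain ⟨n, rfl⟩ := hsurj y
      have hsk : Equiv.swap (f i) (f j) (f k) = f k := Equiv.swap_apply_of_ne_of_ne hki hkj
      rcases hl m with rfl | rfl | rfl <;> rcases hl n with rfl | rfl | rfl <;>
        simp [hsk, hi, hj, hi.symm, hj.symm, G.adj_comm]
  have hnbr : ∀ i, ∃ j, j ≠ i ∧ G.Adj (f i) (f j) := by
    intro i
    have : Nontrivial V := ⟨f 0, f 1, fun h => by simpa using hinj h⟩
    obtain ⟨y, hy⟩ := hG.preconnected.exists_adj_of_nontrivial (f i)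
    obtain ⟨j, rfl⟩ := hsurj y
    exact ⟨j, fun h => hy.ne (by rw [h]), hy⟩
  obtain ⟨j0, h0, a0⟩ := hnbr 0
  obtain ⟨j1, h1, a1⟩ := hnbr 1
  obtain ⟨j2, h2, a2⟩ := hnbr 2
  have k2 := hswap 0 1 2 (by decide) (by decide)
  have k1 := hswap 0 2 1 (by decide) (by decide)
  have k0 := hswap 1 2 0 (by decide) (by decide)
  have s01 := G.adj_comm (f 0) (f 1)
  have s02 := G.adj_comm (f 0) (f 2)
  have s12 := G.adj_comm (f 1) (f 2)
  fin_cases j0 <;> fin_cases j1 <;> fin_cases j2 <;> simp at h0 h1 h2 a0 a1 a2 <;> tauto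

end graph

/-! ### The fibres of a graph with three eigenvalues and coherent rank nine -/

section ranknine

variable {V : Type*} [Fintype V] [DecidableEq V] {G : SimpleGraph V} [DecidableRel G.Adj]

/-- The degrees are the diagonal entries of A². -/
theorem degree_eq_of_fibre_eq {x y : V} (h : relationThrough (coherentClosure G) (x, x) =
    relationThrough (coherentClosure G) (y, y)) : G.degree x = G.degree y := by
  have hA := adjMatrix_mem_coherentClosure G
  have := relationThrough_eq_iff.1 h _ ((coherentClosure G).mul_mem hA hA)
  simpa only [SimpleGraph.adjMatrix_mul_self_apply_self, Nat.cast_inj] using this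

/-- The entries of the vector `α` depend on the degrees only. -/
theorem eq_of_degree_eq {α : V → ℝ} {τ δ : ℝ} (hα : ∀ x, 0 < α x)
    (hsq : ∀ x y, (G.adjMatrix ℝ * G.adjMatrix ℝ) x y =
      τ * G.adjMatrix ℝ x y - δ * (1 : Matrix V V ℝ) x y + α x * α y) {x y : V}
    (h : G.degree x = G.degree y) : α x = α y := by
  have h1 := hsq x x
  have h2 := hsq y y
  rw [SimpleGraph.adjMatrix_mul_self_apply_self] at h1 h2
  rw [h] at h1
  simp only [SimpleGraph.adjMatrix_apply, SimpleGraph.irrefl, if_false, one_apply_eq] at h1 h2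
  have : α x * α x = α y * α y := by linarith
  exact (mul_self_inj (hα x).le (hα y).le).1 this

theorem complex_sq {α : V → ℝ} {τ δ : ℝ}
    (hsq : ∀ x y, (G.adjMatrix ℝ * G.adjMatrix ℝ) x y =
      τ * G.adjMatrix ℝ x y - δ * (1 : Matrix V V ℝ) x y + α x * α y) (x y : V) :
    ∑ z, G.adjMatrix ℂ x z * G.adjMatrix ℂ z y =
      (τ : ℂ) * G.adjMatrix ℂ x y - (δ : ℂ) * (1 : Matrix V V ℂ) x y + α x * α y := by
  have hc : ∀ u v, G.adjMatrix ℂ u v = ((G.adjMatrix ℝ u v : ℝ) : ℂ) := by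
    intro u v
    rw [SimpleGraph.adjMatrix_apply, SimpleGraph.adjMatrix_apply]
    split_ifs <;> simp
  have h1 : (1 : Matrix V V ℂ) x y = (((1 : Matrix V V ℝ) x y : ℝ) : ℂ) := by
    rw [one_apply, one_apply]
    split_ifs <;> simp
  have := hsq x y
  rw [mul_apply] at this
  simp only [hc, h1]
  exact_mod_cast this

/-- A regular graph with three eigenvalues has coherent rank at most three. -/
theorem rank_le_of_regular {α : V → ℝ} {τ δ : ℝ} (hα : ∀ x, 0 < α x)
    (hsq : ∀ x y, (G.adjMatrix ℝ * G.adjMatrix ℝ) x y =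
      τ * G.adjMatrix ℝ x y - δ * (1 : Matrix V V ℝ) x y + α x * α y) (o : V)
    (hreg : ∀ x, G.degree x = G.degree o) : rank (coherentClosure G) ≤ 3 := by
  have hM : ∀ M ∈ coherentClosure G, IsBlockCombination G (fun _ => true) M := fun M hM =>
    isBlockCombination_of_mem_coherentClosure (τ := τ) (δ := δ)
      (γ := fun _ _ => α o * α o) (d := fun _ j => if j = true then G.degree o else 0)
      -- The whole vertex set is the cell `true`; the cell `false` is empty, so flatness is vacuous.
      (σ := fun _ => false) (s := 0) (t := 0)
      (by
        intro x j
        cases j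
        · simp
        · simp [← hreg x, SimpleGraph.adjMatrix_apply, ← G.card_neighborFinset_eq_degree,
            SimpleGraph.neighborFinset_eq_filter])
      (by
        intro x y
        rw [complex_sq hsq, eq_of_degree_eq hα hsq (hreg x), eq_of_degree_eq hα hsq (hreg y)])
      (by simp) hM
  rw [rank_eq_relationCount]
  refine (relationCount_le (κ := Option Bool)
    (fun p => if p.1 = p.2 then none else some (decide (G.Adj p.1 p.2))) ?_).trans (by simp)
  intro p _ q _ h
  refine relationThrough_eq_of_block hM rfl rfl ?_ ?_
  · split_ifs at h <;> simp_all
  · by_cases h1 : p.1 = p.2 <;> by_cases h2 : q.1 = q.2 <;> simp_all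

variable {a b : V}

open Classical in
-- Fibres are equitable and α is constant on them, so flatness is the only regularity condition left
-- to supply.
theorem isBlockCombination_of_flat {α : V → ℝ} {τ δ : ℝ} (hα : ∀ x, 0 < α x)
    (hsq : ∀ x y, (G.adjMatrix ℝ * G.adjMatrix ℝ) x y =
      τ * G.adjMatrix ℝ x y - δ * (1 : Matrix V V ℝ) x y + α x * α y)
    (hab : relationThrough (coherentClosure G) (a, a) ≠ relationThrough (coherentClosure G) (b, b))
    (hcov : ∀ x, relationThrough (coherentClosure G) (x, x) =
        relationThrough (coherentClosure G) (a, a) ∨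
      relationThrough (coherentClosure G) (x, x) = relationThrough (coherentClosure G) (b, b))
    {ψ : V → Bool} (hψ : ∀ x, ψ x = true ↔ relationThrough (coherentClosure G) (x, x) =
        relationThrough (coherentClosure G) (a, a)) {σ : Bool → Bool} {s t : Bool → ℂ}
    (hflat : ∀ x z, ψ z = σ (ψ x) → G.adjMatrix ℂ x z = s (ψ x) + t (ψ x) * (1 : Matrix V V ℂ) x z)
    {M : Matrix V V ℂ} (hM : M ∈ coherentClosure G) : IsBlockCombination G ψ M := by
  have hψ' : ∀ x, ψ x = false ↔ relationThrough (coherentClosure G) (x, x) =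
      relationThrough (coherentClosure G) (b, b) := by
    intro x
    rw [← Bool.not_eq_true, hψ]
    exact ⟨(hcov x).resolve_left, fun h h' => hab (h'.symm.trans h)⟩
  have hrep : ∀ x, relationThrough (coherentClosure G) (x, x) =
      relationThrough (coherentClosure G) (bif ψ x then a else b, bif ψ x then a else b) := by
    intro x
    cases h : ψ x
    · exact (hψ' x).1 h
    · exact (hψ x).1 h
  have hrj : ∀ (z : V) (j : Bool), ψ z = j ↔ relationThrough (coherentClosure G) (z, z) =
      relationThrough (coherentClosure G) (bif j then a else b, bif j then a else b) := by
    intro z j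
    cases j
    · exact hψ' z
    · exact hψ z
  have hS := isCoherent_coherentClosure G
  refine isBlockCombination_of_mem_coherentClosure (τ := τ) (δ := δ)
    (γ := fun i k => α (bif i then a else b) * α (bif k then a else b))
    (d := fun i j => ∑ z, if ψ z = j then G.adjMatrix ℂ (bif i then a else b) z else 0)
    ?_ ?_ hflat hM
  · intro x j
    have := sum_fibre_eq hS (adjMatrix_mem_coherentClosure G) hS.allOnes_mem
      (bif j then a else b) (hrep x)
    simpa only [hrj, allOnes, of_apply, mul_one] using this
  · intro x y
    rw [complex_sq hsq, eq_of_degree_eq hα hsq (degree_eq_of_fibre_eq (hrep x)),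
      eq_of_degree_eq hα hsq (degree_eq_of_fibre_eq (hrep y))]

/-- A join of two fibres has few relations. -/
theorem rank_le_of_join {α : V → ℝ} {τ δ : ℝ} (hα : ∀ x, 0 < α x)
    (hsq : ∀ x y, (G.adjMatrix ℝ * G.adjMatrix ℝ) x y =
      τ * G.adjMatrix ℝ x y - δ * (1 : Matrix V V ℝ) x y + α x * α y)
    {X Y : Finset V}
    (hX : ∀ x, x ∈ X ↔ relationThrough (coherentClosure G) (x, x) =
        relationThrough (coherentClosure G) (a, a))
    (hY : ∀ x, x ∈ Y ↔ relationThrough (coherentClosure G) (x, x) =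
        relationThrough (coherentClosure G) (b, b))
    (hab : relationThrough (coherentClosure G) (a, a) ≠ relationThrough (coherentClosure G) (b, b))
    (hcov : ∀ x, x ∈ X ∨ x ∈ Y) (hj : ∀ x ∈ X, ∀ y ∈ Y, G.Adj x y) :
    rank (coherentClosure G) ≤ 8 := by
  have hXY : ∀ x, x ∈ X → x ∉ Y := fun x h1 h2 => hab (((hX x).1 h1).symm.trans ((hY x).1 h2))
  have hψ : ∀ x, decide (x ∈ X) = false ↔ x ∈ Y := fun x => by
    rw [decide_eq_false_iff_not]
    exact ⟨(hcov x).resolve_left, fun h h' => hXY x h' h⟩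
  have hM : ∀ M ∈ coherentClosure G, IsBlockCombination G (fun x => decide (x ∈ X)) M :=
    fun M hM => isBlockCombination_of_flat hα hsq hab
      (fun x => (hcov x).imp (hX x).1 (hY x).1) (by simpa using hX)
      -- In a join the off-diagonal blocks are J, hence flat.
      (σ := fun i => !i) (s := 1) (t := 0)
      (by
        intro x z h
        rw [SimpleGraph.adjMatrix_apply, if_pos]
        · simp
        · by_cases hx : x ∈ X
          · exact hj x hx z ((hψ z).1 (by simpa [hx] using h))
          · exact (hj z (by simpa [hx] using h) x ((hcov x).resolve_left hx)).symm) hM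
  have hS := isCoherent_coherentClosure G
  have hdiag : ∀ Z : Finset V, (∀ x ∈ Z, ∀ y ∈ Z, (x ∈ X ↔ y ∈ X)) →
      relationCount (coherentClosure G) Z Z ≤ 3 := by
    intro Z hZ
    refine (relationCount_le (κ := Option Bool)
      (fun p => if p.1 = p.2 then none else some (decide (G.Adj p.1 p.2))) ?_).trans (by simp)
    intro p hp q hq h
    rw [Finset.mem_product] at hp hq
    refine relationThrough_eq_of_block hM (decide_eq_decide.2 (hZ _ hp.1 _ hq.1))
      (decide_eq_decide.2 (hZ _ hp.2 _ hq.2)) ?_ ?_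
    · split_ifs at h <;> simp_all
    · by_cases h1 : p.1 = p.2 <;> by_cases h2 : q.1 = q.2 <;> simp_all
  have hoff : relationCount (coherentClosure G) X Y ≤ 1 := by
    refine (relationCount_le (κ := Unit) (fun _ => ()) ?_).trans (by simp)
    intro p hp q hq _
    rw [Finset.mem_product] at hp hq
    refine relationThrough_eq_of_block hM (decide_eq_decide.2 (iff_of_true hp.1 hq.1))
      (decide_eq_decide.2 (iff_of_false (fun h => hXY _ h hp.2) fun h => hXY _ h hq.2))
      (iff_of_false ?_ ?_) (iff_of_true (hj _ hp.1 _ hp.2) (hj _ hq.1 _ hq.2))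
    · exact fun h => hXY _ hp.1 (h ▸ hp.2)
    · exact fun h => hXY _ hq.1 (h ▸ hq.2)
  have h1 := hdiag X fun x hx y hy => iff_of_true hx hy
  have h2 := hdiag Y fun x hx y hy => iff_of_false (fun h => hXY x h hx) fun h => hXY y h hy
  rw [rank_eq_of_partition hS hcov
    fun x hx y hy h => hab (((hX x).1 hx).symm.trans (h.trans ((hY y).1 hy)))]
  omega

/-- If adjacency of distinct vertices is constant on both fibres, then the second fibre carries at
most two relations. -/
theorem relationCount_le_of_flat {α : V → ℝ} {τ δ : ℝ} (hα : ∀ x, 0 < α x)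
    (hsq : ∀ x y, (G.adjMatrix ℝ * G.adjMatrix ℝ) x y =
      τ * G.adjMatrix ℝ x y - δ * (1 : Matrix V V ℝ) x y + α x * α y)
    {X Y : Finset V}
    (hX : ∀ x, x ∈ X ↔ relationThrough (coherentClosure G) (x, x) =
        relationThrough (coherentClosure G) (a, a))
    (hY : ∀ x, x ∈ Y ↔ relationThrough (coherentClosure G) (x, x) =
        relationThrough (coherentClosure G) (b, b))
    (hab : relationThrough (coherentClosure G) (a, a) ≠ relationThrough (coherentClosure G) (b, b))
    (hcov : ∀ x, x ∈ X ∨ x ∈ Y) {p q : Prop} (hp : ∀ x ∈ X, ∀ y ∈ X, x ≠ y → (G.Adj x y ↔ p))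
    (hq : ∀ x ∈ Y, ∀ y ∈ Y, x ≠ y → (G.Adj x y ↔ q)) :
    relationCount (coherentClosure G) Y Y ≤ 2 := by
  classical
  have hXY : ∀ x, x ∈ X → x ∉ Y := fun x h1 h2 => hab (((hX x).1 h1).symm.trans ((hY x).1 h2))
  have hM : ∀ M ∈ coherentClosure G, IsBlockCombination G (fun x => decide (x ∈ X)) M :=
    fun M hM => isBlockCombination_of_flat hα hsq hab
      (fun x => (hcov x).imp (hX x).1 (hY x).1) (by simpa using hX)
      -- Here the diagonal blocks are flat: each is 0 or J - I, whence t = -s.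
      (σ := fun i => i) (s := fun i => if (if i then p else q) then 1 else 0)
      (t := fun i => -if (if i then p else q) then 1 else 0)
      (by
        intro x z h
        by_cases hxz : x = z
        · subst hxz
          simp
        · rw [SimpleGraph.adjMatrix_apply, one_apply_ne hxz]
          by_cases hx : x ∈ X
          · rw [if_congr (hp x hx z (by simpa [hx] using h) hxz) rfl rfl]
            simp [hx]
          · have hz : z ∉ X := by simpa [hx] using h
            rw [if_congr (hq x ((hcov x).resolve_left hx) z ((hcov z).resolve_left hz) hxz) rfl rfl]
            simp [hx]) hM
  refine (relationCount_le (κ := Bool) (fun p => decide (p.1 = p.2)) ?_).trans (by simp)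
  intro u hu v hv h
  rw [Finset.mem_product] at hu hv
  have huv : u.1 = u.2 ↔ v.1 = v.2 := decide_eq_decide.1 h
  refine relationThrough_eq_of_block hM
    (decide_eq_decide.2 (iff_of_false (fun h => hXY _ h hu.1) fun h => hXY _ h hv.1))
    (decide_eq_decide.2 (iff_of_false (fun h => hXY _ h hu.2) fun h => hXY _ h hv.2)) huv ?_
  by_cases hu' : u.1 = u.2
  · exact iff_of_false (fun h => h.ne hu') fun h => h.ne (huv.1 hu')
  · rw [hq _ hu.1 _ hu.2 hu', hq _ hv.1 _ hv.2 fun h => hu' (huv.2 h)]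

end ranknine

/-! ### The two fibres and the type. -/

section ranknine

variable {V : Type*} [Fintype V] [DecidableEq V]

/-- Two fibres `X`, `Y` of the coherent closure that cover the vertex set and distinguish the
degrees. -/
structure IsFibrePair (G : SimpleGraph V) [DecidableRel G.Adj] (X Y : Finset V) : Prop where
  left_nonempty : X.Nonempty
  right_nonempty : Y.Nonempty
  cover : ∀ x, x ∈ X ∨ x ∈ Y
  left_fibre : ∀ x ∈ X, ∀ y, y ∈ X ↔
    relationThrough (coherentClosure G) (y, y) = relationThrough (coherentClosure G) (x, x)
  right_fibre : ∀ x ∈ Y, ∀ y, y ∈ Y ↔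
    relationThrough (coherentClosure G) (y, y) = relationThrough (coherentClosure G) (x, x)
  degree_ne : ∀ x ∈ X, ∀ y ∈ Y, G.degree x ≠ G.degree y

variable {G : SimpleGraph V} [DecidableRel G.Adj] {X Y : Finset V}

theorem IsFibrePair.fibre_ne (h : IsFibrePair G X Y) : ∀ x ∈ X, ∀ y ∈ Y,
    relationThrough (coherentClosure G) (x, x) ≠ relationThrough (coherentClosure G) (y, y) :=
  fun x hx y hy e => h.degree_ne x hx y hy (degree_eq_of_fibre_eq e)

theorem IsFibrePair.symm (h : IsFibrePair G X Y) : IsFibrePair G Y X where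
  left_nonempty := h.right_nonempty
  right_nonempty := h.left_nonempty
  cover := fun x => (h.cover x).symm
  left_fibre := h.right_fibre
  right_fibre := h.left_fibre
  degree_ne := fun x hx y hy => (h.degree_ne y hy x hx).symm

theorem IsFibrePair.notMem (h : IsFibrePair G X Y) {x : V} (hx : x ∈ X) : x ∉ Y :=
  fun hy => h.degree_ne x hx x hy rfl

theorem IsFibrePair.exists_adj (h : IsFibrePair G X Y) (hG : G.Connected) :
    ∃ x ∈ X, ∃ y ∈ Y, G.Adj x y := by
  obtain ⟨a, ha⟩ := h.left_nonempty
  obtain ⟨b, hb⟩ := h.right_nonempty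
  obtain ⟨p⟩ := hG.preconnected a b
  obtain ⟨d, -, hd1, hd2⟩ := p.exists_boundary_dart (X : Set V) (by simpa using ha)
    (by simpa using h.symm.notMem hb)
  exact ⟨d.fst, by simpa using hd1, d.snd, (h.cover _).resolve_left (by simpa using hd2), d.adj⟩

variable {α : V → ℝ} {τ δ : ℝ}

/-- The coherent closure of a graph in `𝒢₃` with coherent rank nine has two fibres. -/
theorem exists_isFibrePair (hG : G.Connected) (hα : ∀ x, 0 < α x)
    (hsq : ∀ x y, (G.adjMatrix ℝ * G.adjMatrix ℝ) x y =
      τ * G.adjMatrix ℝ x y - δ * (1 : Matrix V V ℝ) x y + α x * α y)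
    (hr : rank (coherentClosure G) = 9) : ∃ X Y : Finset V, IsFibrePair G X Y := by
  classical
  have hS := isCoherent_coherentClosure G
  set φ : V → Set (V × V) := fun x => relationThrough (coherentClosure G) (x, x) with hφ
  have htwo : ∃ a b, ∀ x, φ x = φ a ∨ φ x = φ b := by
    by_contra! hc
    obtain ⟨a⟩ := hG.nonempty
    obtain ⟨b, hb, -⟩ := hc a a
    obtain ⟨c, hca, hcb⟩ := hc a b
    have hf : Function.Injective fun i => φ ((![a, b, c] : Fin 3 → V) i) := by
      intro i j
      fin_cases i <;> fin_cases j <;> simp [hb, hca, hcb, hb.symm, hca.symm, hcb.symm]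
    exact not_three_fibres hG hf (surjective_of_rank hS hr hf)
  obtain ⟨a, b, hcov⟩ := htwo
  have hdeg : G.degree a ≠ G.degree b := by
    intro he
    have := rank_le_of_regular hα hsq b fun x => (hcov x).elim
      (fun h => (degree_eq_of_fibre_eq h).trans he) fun h => degree_eq_of_fibre_eq h
    omega
  refine ⟨Finset.univ.filter fun x => φ x = φ a, Finset.univ.filter fun x => φ x = φ b,
    ⟨a, by simp⟩, ⟨b, by simp⟩, by simpa using hcov, ?_, ?_, ?_⟩
  · intro x hx y
    rw [Finset.mem_filter] at hx ⊢
    rw [← hx.2]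
    simp [hφ]
  · intro x hx y
    rw [Finset.mem_filter] at hx ⊢
    rw [← hx.2]
    simp [hφ]
  · intro x hx y hy
    rw [Finset.mem_filter] at hx hy
    rwa [degree_eq_of_fibre_eq hx.2, degree_eq_of_fibre_eq hy.2]

theorem IsFibrePair.exists_not_adj (h : IsFibrePair G X Y) (hα : ∀ x, 0 < α x)
    (hsq : ∀ x y, (G.adjMatrix ℝ * G.adjMatrix ℝ) x y =
      τ * G.adjMatrix ℝ x y - δ * (1 : Matrix V V ℝ) x y + α x * α y)
    (hr : rank (coherentClosure G) = 9) : ∃ x ∈ X, ∃ y ∈ Y, ¬ G.Adj x y := by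
  by_contra! hj
  obtain ⟨a, ha⟩ := h.left_nonempty
  obtain ⟨b, hb⟩ := h.right_nonempty
  have := rank_le_of_join hα hsq (h.left_fibre a ha) (h.right_fibre b hb) (h.fibre_ne a ha b hb)
    h.cover hj
  omega

/-- The numbers of relations between the fibres, which determine the type. -/
theorem IsFibrePair.relationCount_eq (h : IsFibrePair G X Y) (hG : G.Connected) (hα : ∀ x, 0 < α x)
    (hsq : ∀ x y, (G.adjMatrix ℝ * G.adjMatrix ℝ) x y =
      τ * G.adjMatrix ℝ x y - δ * (1 : Matrix V V ℝ) x y + α x * α y)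
    (hr : rank (coherentClosure G) = 9)
    (hle : relationCount (coherentClosure G) X X ≤ relationCount (coherentClosure G) Y Y) :
    relationCount (coherentClosure G) X X = 2 ∧ relationCount (coherentClosure G) X Y = 2 ∧
      relationCount (coherentClosure G) Y Y = 3 := by
  classical
  have hS := isCoherent_coherentClosure G
  have hsum := rank_eq_of_partition hS h.cover h.fibre_ne
  obtain ⟨x, hx, y, hy, hxy⟩ := h.exists_adj hG
  obtain ⟨u, hu, v, hv, huv⟩ := h.exists_not_adj hα hsq hr
  have h12 : 2 ≤ relationCount (coherentClosure G) X Y := by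
    refine Finset.one_lt_card.2 ⟨_, Finset.mem_image_of_mem _ (Finset.mk_mem_product hx hy), _,
      Finset.mem_image_of_mem _ (Finset.mk_mem_product hu hv), fun e => ?_⟩
    exact huv ((adj_iff_of_relationThrough_eq e).1 hxy)
  have h11 : 2 ≤ relationCount (coherentClosure G) X X := by
    by_cases hs : ∃ w ∈ X, w ≠ x
    · obtain ⟨w, hw, hne⟩ := hs
      exact exists_card_le_of_relationCount hw hx hne
    · push Not at hs
      have hX : X = {x} := by
        ext w
        rw [Finset.mem_singleton]
        exact ⟨hs w, fun e => e ▸ hx⟩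
      have := relationCount_eq_one hS (a := x) (Y := Y) h.right_nonempty
        (fun w hw => hs w ((h.left_fibre x hx w).2 hw))
        (fun y hy y' hy' => (h.right_fibre y' hy' y).1 hy)
      rw [← hX] at this
      omega
  -- Now r₁₁ + 2r₁₂ + r₂₂ = 9 with 2 ≤ r₁₁ ≤ r₂₂ and r₁₂ ≥ 2; r₁₂ ≥ 3 would leave too little for the
  -- diagonal blocks.
  omega

theorem exists_isFibrePair_relationCount (hG : G.Connected) (hα : ∀ x, 0 < α x)
    (hsq : ∀ x y, (G.adjMatrix ℝ * G.adjMatrix ℝ) x y =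
      τ * G.adjMatrix ℝ x y - δ * (1 : Matrix V V ℝ) x y + α x * α y)
    (hr : rank (coherentClosure G) = 9) : ∃ X Y : Finset V, IsFibrePair G X Y ∧
    relationCount (coherentClosure G) X X = 2 ∧ relationCount (coherentClosure G) X Y = 2 ∧
      relationCount (coherentClosure G) Y Y = 3 := by
  obtain ⟨X, Y, h⟩ := exists_isFibrePair hG hα hsq hr
  rcases le_total (relationCount (coherentClosure G) X X)
    (relationCount (coherentClosure G) Y Y) with hle | hle
  · exact ⟨X, Y, h, h.relationCount_eq hG hα hsq hr hle⟩
  · exact ⟨Y, X, h.symm, h.symm.relationCount_eq hG hα hsq hr hle⟩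

theorem typeEntry_eq_relationCount {S : Subalgebra ℂ (Matrix V V ℂ)} (hS : IsCoherent S)
    {Z W : Finset V}
    (hZ : ∀ x ∈ Z, ∀ y, y ∈ Z ↔ relationThrough S (y, y) = relationThrough S (x, x))
    (hW : ∀ x ∈ W, ∀ y, y ∈ W ↔ relationThrough S (y, y) = relationThrough S (x, x)) :
    typeEntry S (Z : Set V) (W : Set V) = relationCount S Z W := by
  classical
  rw [typeEntry, relationCount, ← Set.ncard_coe_finset]
  congr 1
  ext R
  simp only [Set.mem_ofPred_eq, Finset.coe_image, Set.mem_image, Finset.mem_coe,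
    Finset.mem_product]
  constructor
  · rintro ⟨⟨p, rfl⟩, hp⟩
    have : p ∈ relationThrough S p := fun M _ => rfl
    exact ⟨p, by simpa using hp this, rfl⟩
  · rintro ⟨⟨x, y⟩, ⟨hx, hy⟩, rfl⟩
    refine ⟨⟨_, rfl⟩, ?_⟩
    rintro ⟨u, v⟩ huv
    have e : relationThrough S (u, v) = relationThrough S (x, y) := relationThrough_eq_iff.2 huv
    exact ⟨(hZ x hx u).2 (fibre_fst_eq hS e), (hW y hy v).2 (fibre_snd_eq hS e)⟩

theorem mem_fibres_iff {S : Subalgebra ℂ (Matrix V V ℂ)} {F : Set V} :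
    F ∈ fibres S ↔ ∃ x, F = {y | relationThrough S (y, y) = relationThrough S (x, x)} := by
  have hmem : ∀ x y, (y, y) ∈ relationThrough S (x, x) ↔
      relationThrough S (y, y) = relationThrough S (x, x) :=
    fun x y => relationThrough_eq_iff.symm
  constructor
  · rintro ⟨_, ⟨⟨x, y⟩, rfl⟩, hsub, rfl⟩
    obtain rfl : x = y := hsub (show (x, y) ∈ relationThrough S (x, y) from fun M _ => rfl)
    exact ⟨x, Set.ext fun y => hmem x y⟩
  · rintro ⟨x, rfl⟩
    refine ⟨relationThrough S (x, x), ⟨_, rfl⟩, ?_, Set.ext fun y => (hmem x y).symm⟩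
    rintro ⟨u, v⟩ h
    exact (eq_iff_of_relationThrough_eq
      (relationThrough_eq_iff.2 h : relationThrough S (u, v) = _)).2 rfl

theorem IsFibrePair.hasTypeWith (h : IsFibrePair G X Y) {k l m : ℕ}
    (hk : relationCount (coherentClosure G) X X = k)
    (hl : relationCount (coherentClosure G) X Y = l)
    (hm : relationCount (coherentClosure G) Y Y = m) :
    HasTypeWith (coherentClosure G) ![(X : Set V), (Y : Set V)] !![k, l; l, m] := by
  have hS := isCoherent_coherentClosure G
  have hset : ∀ {Z : Finset V} {x : V}, (∀ y, y ∈ Z ↔ relationThrough (coherentClosure G) (y, y) =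
      relationThrough (coherentClosure G) (x, x)) → (Z : Set V) = {y | relationThrough
        (coherentClosure G) (y, y) = relationThrough (coherentClosure G) (x, x)} :=
    fun hZ => Set.ext fun y => hZ y
  obtain ⟨a, ha⟩ := h.left_nonempty
  obtain ⟨b, hb⟩ := h.right_nonempty
  have hne : (X : Set V) ≠ Y := fun e => h.notMem ha (by
    have : a ∈ (Y : Set V) := e ▸ (by simpa using ha)
    simpa using this)
  refine ⟨?_, ?_, ?_⟩
  · intro i j
    fin_cases i <;> fin_cases j <;> simp [hne, hne.symm]
  · ext F
    rw [mem_fibres_iff]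
    simp only [Set.mem_range, Fin.exists_fin_two, cons_val_zero, cons_val_one]
    constructor
    · rintro (rfl | rfl)
      · exact ⟨a, hset (h.left_fibre a ha)⟩
      · exact ⟨b, hset (h.right_fibre b hb)⟩
    · rintro ⟨x, rfl⟩
      rcases h.cover x with hx | hx
      · exact Or.inl (hset (h.left_fibre x hx))
      · exact Or.inr (hset (h.right_fibre x hx))
  · intro i j
    have h21 := relationCount_comm hS X Y
    fin_cases i <;> fin_cases j
    · exact (typeEntry_eq_relationCount hS h.left_fibre h.left_fibre).trans hk
    · exact (typeEntry_eq_relationCount hS h.left_fibre h.right_fibre).trans hl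
    · exact (typeEntry_eq_relationCount hS h.right_fibre h.left_fibre).trans (h21.symm.trans hl)
    · exact (typeEntry_eq_relationCount hS h.right_fibre h.right_fibre).trans hm

end ranknine

/-! ### Constant numbers of common neighbours. -/

section parameters

variable {V : Type*} [Fintype V] [DecidableEq V]

/-- The diagonal pairs use up one relation, so only one remains for the pairs of distinct points. -/
theorem relationThrough_eq_of_count_le_two {S : Subalgebra ℂ (Matrix V V ℂ)} {X : Finset V}
    (h : relationCount S X X ≤ 2) {x y x' y' : V} (hx : x ∈ X) (hy : y ∈ X) (hx' : x' ∈ X)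
    (hy' : y' ∈ X) (hxy : x ≠ y) (hxy' : x' ≠ y') :
    relationThrough S (x, y) = relationThrough S (x', y') := by
  classical
  by_contra hne
  refine absurd h (not_le.2 (Finset.two_lt_card.2 ⟨relationThrough S (x, x),
    Finset.mem_image_of_mem _ (by simp [hx]), relationThrough S (x, y),
    Finset.mem_image_of_mem _ (by simp [hx, hy]), relationThrough S (x', y'),
    Finset.mem_image_of_mem _ (by simp [hx', hy']), fun e => ?_, fun e => ?_, hne⟩))
  · exact hxy ((eq_iff_of_relationThrough_eq e).1 rfl)
  · exact hxy' ((eq_iff_of_relationThrough_eq e).1 rfl)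

theorem relationThrough_eq_of_count_le_three {S : Subalgebra ℂ (Matrix V V ℂ)} {X : Finset V}
    (h : relationCount S X X ≤ 3) {x y x' y' u v : V} (hx : x ∈ X) (hy : y ∈ X) (hx' : x' ∈ X)
    (hy' : y' ∈ X) (hu : u ∈ X) (hv : v ∈ X) (hxy : x ≠ y) (hxy' : x' ≠ y') (huv : u ≠ v)
    (h1 : relationThrough S (u, v) ≠ relationThrough S (x, y))
    (h2 : relationThrough S (u, v) ≠ relationThrough S (x', y')) :
    relationThrough S (x, y) = relationThrough S (x', y') := by
  classical
  by_contra hne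
  have hsub : ({relationThrough S (x, x), relationThrough S (u, v), relationThrough S (x, y),
      relationThrough S (x', y')} : Finset _) ⊆ (X ×ˢ X).image (relationThrough S) := by
    intro R hR
    simp only [Finset.mem_insert, Finset.mem_singleton] at hR
    rcases hR with rfl | rfl | rfl | rfl <;> exact Finset.mem_image_of_mem _ (by simp [*])
  have hd : ∀ {w z : V}, w ≠ z → relationThrough S (x, x) ≠ relationThrough S (w, z) :=
    fun hwz e => hwz ((eq_iff_of_relationThrough_eq e).1 rfl)
  have hc := (Finset.card_le_card hsub).trans h
  rw [Finset.card_insert_of_notMem (by simp [hd hxy, hd hxy', hd huv]),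
    Finset.card_insert_of_notMem (by simp [h1, h2]), Finset.card_pair hne] at hc
  omega

variable (G : SimpleGraph V) [DecidableRel G.Adj]

/-- The number of common neighbours of `u` and `v` in `Z`. -/
def commonCount (Z : Finset V) (u v : V) : ℕ :=
  (Z.filter fun z => G.Adj u z ∧ G.Adj v z).card

variable {G} {X Y : Finset V}

/-- With D the diagonal matrix of the fibre, these numbers are the entries of ADA. -/
theorem commonCount_eq {Z : Finset V} {w : V} (hZ : ∀ z, z ∈ Z ↔
      relationThrough (coherentClosure G) (z, z) = relationThrough (coherentClosure G) (w, w))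
    {u v u' v' : V} (h : relationThrough (coherentClosure G) (u, v) =
      relationThrough (coherentClosure G) (u', v')) :
    commonCount G Z u v = commonCount G Z u' v' := by
  classical
  have hA := adjMatrix_mem_coherentClosure G
  have := sum_fibre_eq (isCoherent_coherentClosure G) hA hA w h
  have e : ∀ u v, (∑ z, if relationThrough (coherentClosure G) (z, z) =
      relationThrough (coherentClosure G) (w, w) then G.adjMatrix ℂ u z * G.adjMatrix ℂ z v
      else 0) = (commonCount G Z u v : ℂ) := by
    intro u v
    simp only [← hZ, adjMatrix_comm _ v]
    simp only [SimpleGraph.adjMatrix_apply, ← ite_and, mul_ite, mul_one, mul_zero]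
    rw [commonCount, Finset.sum_boole]
    congr 2
    ext z
    simp [and_comm]
  rw [e, e] at this
  exact_mod_cast this

/-- The parameters of the fibres of a graph in `𝒢₃` with coherent rank nine. -/
structure HasParameters (G : SimpleGraph V) [DecidableRel G.Adj] (X Y : Finset V) (p : Prop)
    (k₁₁ k₁₂ k₂₁ k₂₂ lam x y : ℕ) : Prop where
  adj_left : ∀ u ∈ X, ∀ v ∈ X, u ≠ v → (G.Adj u v ↔ p)
  count₁₁ : ∀ u ∈ X, commonCount G X u u = k₁₁
  count₁₂ : ∀ u ∈ X, commonCount G Y u u = k₁₂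
  count₂₁ : ∀ u ∈ Y, commonCount G X u u = k₂₁
  count₂₂ : ∀ u ∈ Y, commonCount G Y u u = k₂₂
  count_left : ∀ u ∈ X, ∀ v ∈ X, u ≠ v → commonCount G Y u v = lam
  count_adj : ∀ u ∈ Y, ∀ v ∈ Y, G.Adj u v → commonCount G X u v = x
  count_not_adj : ∀ u ∈ Y, ∀ v ∈ Y, u ≠ v → ¬ G.Adj u v → commonCount G X u v = y
  exists_adj : ∃ u ∈ Y, ∃ v ∈ Y, G.Adj u v
  exists_not_adj : ∃ u ∈ Y, ∃ v ∈ Y, u ≠ v ∧ ¬ G.Adj u v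
  one_lt_card : 1 < X.card

theorem IsFibrePair.exists_hasParameters (h : IsFibrePair G X Y) {α : V → ℝ} {τ δ : ℝ}
    (hα : ∀ x, 0 < α x)
    (hsq : ∀ x y, (G.adjMatrix ℝ * G.adjMatrix ℝ) x y =
      τ * G.adjMatrix ℝ x y - δ * (1 : Matrix V V ℝ) x y + α x * α y)
    (h1 : relationCount (coherentClosure G) X X = 2)
    (h2 : relationCount (coherentClosure G) Y Y = 3) :
    ∃ (p : Prop) (k₁₁ k₁₂ k₂₁ k₂₂ lam x y : ℕ), HasParameters G X Y p k₁₁ k₁₂ k₂₁ k₂₂ lam x y := by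
  classical
  obtain ⟨a, ha⟩ := h.left_nonempty
  obtain ⟨b, hb⟩ := h.right_nonempty
  have hX := h.left_fibre a ha
  have hY := h.right_fibre b hb
  have hcard : 1 < X.card := by
    by_contra hc
    have : X ×ˢ X = {(a, a)} := by
      rw [Finset.card_le_one.1 (not_lt.1 hc) |> fun hc => Finset.eq_singleton_iff_unique_mem.2
        ⟨ha, fun x hx => hc x hx a ha⟩]
      simp
    rw [relationCount, this] at h1
    simp at h1
  obtain ⟨u, hu, v, hv, huv⟩ := Finset.one_lt_card.1 hcard
  have hp : ∀ x ∈ X, ∀ y ∈ X, x ≠ y → (G.Adj x y ↔ G.Adj u v) := fun x hx y hy hxy =>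
    adj_iff_of_relationThrough_eq (relationThrough_eq_of_count_le_two h1.le hx hy hu hv hxy huv)
  -- The block on X is flat. If the block on Y were flat too, Y would carry at most two relations
  -- instead of three; so adjacency on Y is neither empty nor complete.
  have hflat : ∀ q : Prop, ¬ ∀ x ∈ Y, ∀ y ∈ Y, x ≠ y → (G.Adj x y ↔ q) := fun q hq => by
    have := relationCount_le_of_flat hα hsq hX hY (h.fibre_ne a ha b hb) h.cover hp hq
    omega
  have hadj : ∃ u ∈ Y, ∃ v ∈ Y, G.Adj u v := by
    by_contra! hc
    exact hflat False fun x hx y hy _ => iff_false_intro (hc x hx y hy)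
  have hnadj : ∃ u ∈ Y, ∃ v ∈ Y, u ≠ v ∧ ¬ G.Adj u v := by
    by_contra! hc
    exact hflat True fun x hx y hy hxy => iff_true_intro (hc x hx y hy hxy)
  obtain ⟨c, hc, d, hd, hcd⟩ := id hadj
  obtain ⟨e, he, f, hf, hef, hef'⟩ := id hnadj
  refine ⟨_, _, _, _, _, _, _, _, hp,
    fun x hx => commonCount_eq hX ((hX x).1 hx), fun x hx => commonCount_eq hY ((hX x).1 hx),
    fun x hx => commonCount_eq hX ((hY x).1 hx), fun x hx => commonCount_eq hY ((hY x).1 hx),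
    fun x hx y hy hxy => commonCount_eq hY
      (relationThrough_eq_of_count_le_two h1.le hx hy hu hv hxy huv),
    fun x hx y hy hxy => commonCount_eq hX (relationThrough_eq_of_count_le_three h2.le hx hy hc hd
      he hf hxy.ne hcd.ne hef (fun e => hef' ((adj_iff_of_relationThrough_eq e).2 hxy))
      fun e => hef' ((adj_iff_of_relationThrough_eq e).2 hcd)),
    fun x hx y hy hne hxy => commonCount_eq hX (relationThrough_eq_of_count_le_three h2.le hx hy
      he hf hc hd hne hef hcd.ne (fun e => hxy ((adj_iff_of_relationThrough_eq e).1 hcd))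
      fun e => hef' ((adj_iff_of_relationThrough_eq e).1 hcd)),
    hadj, hnadj, hcard⟩

end parameters

/-! ### The design, its block graph and the block equations. -/

section assemble

variable {V : Type*} [Fintype V] [DecidableEq V] {G : SimpleGraph V} [DecidableRel G.Adj]
  {X Y : Finset V}

/-- The blocks of the design: the neighbourhoods in `X` of the vertices in `Y`. -/
def neighborBlock (G : SimpleGraph V) [DecidableRel G.Adj] (X Y : Finset V) :
    ↥(Y : Set V) → Finset ↥(X : Set V) :=
  fun i => Finset.univ.filter fun p => G.Adj p i

theorem card_filter_coe {W : Type*} (Z : Finset W) (P : W → Prop) [DecidablePred P] :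
    (Finset.univ.filter fun z : ↥(Z : Set W) => P z).card = (Z.filter P).card := by
  rw [Finset.card_filter, Finset.card_filter]
  exact Finset.sum_finset_coe (fun z => if P z then 1 else 0) Z

theorem commonCount_self {W : Type*} {G : SimpleGraph W} [DecidableRel G.Adj] (Z : Finset W) (u : W) :
    commonCount G Z u u = (Z.filter fun z => G.Adj u z).card := by
  simp [commonCount]

theorem sum_mul_eq_commonCount (Z : Finset V) (u v : V) :
    ∑ z : ↥(Z : Set V), G.adjMatrix ℝ u z * G.adjMatrix ℝ z v = commonCount G Z u v := by
  rw [Finset.sum_finset_coe (fun z => G.adjMatrix ℝ u z * G.adjMatrix ℝ z v) Z, commonCount,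
    Finset.card_filter]
  push_cast
  refine Finset.sum_congr rfl fun z _ => ?_
  simp only [SimpleGraph.adjMatrix_apply, G.adj_comm z v]
  split_ifs <;> simp_all

theorem sum_eq_commonCount (Z : Finset V) (u : V) :
    ∑ z : ↥(Z : Set V), G.adjMatrix ℝ u z = commonCount G Z u u := by
  rw [← sum_mul_eq_commonCount]
  refine Finset.sum_congr rfl fun z _ => ?_
  simp [SimpleGraph.adjMatrix_apply, G.adj_comm u]

theorem incidenceMatrix_neighborBlock (p : ↥(X : Set V)) (i : ↥(Y : Set V)) :
    incidenceMatrix (neighborBlock G X Y) p i = G.adjMatrix ℝ p i := by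
  simp [incidenceMatrix, neighborBlock, SimpleGraph.adjMatrix_apply]

theorem card_neighborBlock (i : ↥(Y : Set V)) :
    (neighborBlock G X Y i).card = commonCount G X i i := by
  rw [neighborBlock, card_filter_coe X fun z => G.Adj z i, commonCount_self]
  simp only [G.adj_comm]

theorem card_neighborBlock_inter (i j : ↥(Y : Set V)) :
    (neighborBlock G X Y i ∩ neighborBlock G X Y j).card = commonCount G X i j := by
  rw [neighborBlock, neighborBlock, ← Finset.filter_and,
    card_filter_coe X fun z => G.Adj z i ∧ G.Adj z j, commonCount]
  simp only [G.adj_comm]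

theorem card_filter_mem_neighborBlock (p q : ↥(X : Set V)) :
    (Finset.univ.filter fun i => p ∈ neighborBlock G X Y i ∧ q ∈ neighborBlock G X Y i).card =
      commonCount G Y p q := by
  simp only [neighborBlock, Finset.mem_filter, Finset.mem_univ, true_and]
  exact card_filter_coe Y fun z => G.Adj p z ∧ G.Adj q z

theorem card_eq_commonCount (Z : Finset V) (u : V) :
    (G.neighborFinset u ∩ Z).card = commonCount G Z u u := by
  rw [commonCount_self]
  congr 1
  ext z
  simp [and_comm]

variable {p : Prop} {k₁₁ k₁₂ k₂₁ k₂₂ lam x y : ℕ}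

theorem HasParameters.isEquitable (h : HasParameters G X Y p k₁₁ k₁₂ k₂₁ k₂₂ lam x y) :
    IsEquitable G ![X, Y] !![k₁₁, k₁₂; k₂₁, k₂₂] := by
  intro i j u hu
  rw [card_eq_commonCount]
  fin_cases i <;> fin_cases j
  exacts [h.count₁₁ u hu, h.count₁₂ u hu, h.count₂₁ u hu, h.count₂₂ u hu]

/-- Splitting the sums in A² over X and Y gives the block equations; the Gram equations only restate
the numbers of common neighbours. -/
theorem HasParameters.isDesignBlock [Decidable p]
    (h : HasParameters G X Y p k₁₁ k₁₂ k₂₁ k₂₂ lam x y)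
    (hF : IsFibrePair G X Y) (hadj : ∃ u ∈ X, ∃ v ∈ Y, G.Adj u v)
    (hnadj : ∃ u ∈ X, ∃ v ∈ Y, ¬ G.Adj u v) {α : V → ℝ} {τ δ α₁ α₂ : ℝ}
    (hsq : ∀ x y, (G.adjMatrix ℝ * G.adjMatrix ℝ) x y =
      τ * G.adjMatrix ℝ x y - δ * (1 : Matrix V V ℝ) x y + α x * α y)
    (hα₁ : ∀ u ∈ X, α u = α₁) (hα₂ : ∀ u ∈ Y, α u = α₂) :
    IsDesignBlock (incidenceMatrix (neighborBlock G X Y))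
      ((G.induce (Y : Set V)).adjMatrix ℝ) (if p then 1 else 0) τ δ (α₂ * α₂) (α₁ * α₂)
      k₂₁ k₁₂ lam x y := by
  obtain ⟨u₀, hu₀, v₀, hv₀, ha₀⟩ := hadj
  obtain ⟨u₁, hu₁, v₁, hv₁, ha₁⟩ := hnadj
  have hN : ∀ i j : ↥(Y : Set V), (G.induce (Y : Set V)).adjMatrix ℝ i j = G.adjMatrix ℝ i j :=
    fun i j => by simp [SimpleGraph.adjMatrix_apply]
  have hA : ∀ u v, G.adjMatrix ℝ u v = G.adjMatrix ℝ v u := fun u v => by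
    simp [SimpleGraph.adjMatrix_apply, G.adj_comm]
  have hgram : ∀ i j : V, ∑ z : ↥(X : Set V), G.adjMatrix ℝ z i * G.adjMatrix ℝ z j =
      ∑ z : ↥(X : Set V), G.adjMatrix ℝ i z * G.adjMatrix ℝ z j :=
    fun i j => Finset.sum_congr rfl fun z _ => by rw [hA z i]
  have hsplit : ∀ u v, (∑ z : ↥(X : Set V), G.adjMatrix ℝ u z * G.adjMatrix ℝ z v) +
      ∑ z : ↥(Y : Set V), G.adjMatrix ℝ u z * G.adjMatrix ℝ z v =
      τ * G.adjMatrix ℝ u v - δ * (1 : Matrix V V ℝ) u v + α u * α v := by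
    intro u v
    rw [← hsq, mul_apply, Finset.sum_finset_coe (fun z => G.adjMatrix ℝ u z * G.adjMatrix ℝ z v) X,
      Finset.sum_finset_coe (fun z => G.adjMatrix ℝ u z * G.adjMatrix ℝ z v) Y,
      ← Finset.sum_union (Finset.disjoint_left.2 fun z => hF.notMem)]
    congr 1
    ext z
    simpa using hF.cover z
  have hleft : ∀ q r : ↥(X : Set V), (if p then (1 : ℝ) else 0) * (1 - (1 : Matrix _ _ ℝ) q r) =
      G.adjMatrix ℝ q r := by
    intro q r
    by_cases hqr : q = r
    · subst hqr
      simp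
    · rw [one_apply_ne hqr, SimpleGraph.adjMatrix_apply, sub_zero, mul_one]
      exact (if_congr (h.adj_left q q.2 r r.2 fun e => hqr (Subtype.ext e)) rfl rfl).symm
  have hx21 : ∀ j : ↥(Y : Set V), commonCount G X j j = k₂₁ := fun j => h.count₂₁ j j.2
  have hx12 : ∀ q : ↥(X : Set V), commonCount G Y q q = k₁₂ := fun q => h.count₁₂ q q.2
  refine ⟨by simp, ?_, ?_, ?_, ?_, ?_, ?_, ?_, ?_, ?_⟩
  · ext q j
    have e := hsplit q j
    have hqj : (q : V) ≠ j := fun e => hF.notMem (Finset.mem_coe.1 q.2) (by rw [e]; exact j.2)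
    rw [hα₁ q q.2, hα₂ j j.2, one_apply_ne hqj] at e
    simp only [Matrix.add_apply, Matrix.smul_apply, mul_apply, smul_eq_mul, allOnes, of_apply,
      Matrix.sub_apply, incidenceMatrix_neighborBlock, hN, Finset.mul_sum, ← mul_assoc, hleft]
    rw [e]
    ring
  · ext i j
    have e := hsplit i j
    rw [hα₂ i i.2, hα₂ j j.2] at e
    have h1 : (1 : Matrix V V ℝ) i j = (1 : Matrix ↥(Y : Set V) ↥(Y : Set V) ℝ) i j := by
      rw [one_apply, one_apply]
      exact if_congr Subtype.ext_iff.symm rfl rfl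
    simp only [Matrix.add_apply, Matrix.smul_apply, mul_apply, smul_eq_mul, allOnes, of_apply,
      Matrix.sub_apply, incidenceMatrix_neighborBlock, hN, transpose_apply]
    rw [h1] at e
    rw [hgram, mul_one, ← e]
  · ext q r
    simp only [mul_apply, transpose_apply, incidenceMatrix_neighborBlock, Matrix.add_apply,
      Matrix.smul_apply, smul_eq_mul, allOnes, of_apply]
    simp only [hA (r : V)]
    rw [sum_mul_eq_commonCount]
    by_cases hqr : q = r
    · subst hqr
      rw [hx12, one_apply_eq]
      ring
    · rw [h.count_left q q.2 r r.2 fun e => hqr (Subtype.ext e), one_apply_ne hqr]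
      ring
  · ext i j
    simp only [mul_apply, transpose_apply, incidenceMatrix_neighborBlock, Matrix.add_apply,
      Matrix.smul_apply, smul_eq_mul, allOnes, of_apply, hN]
    rw [hgram, sum_mul_eq_commonCount]
    by_cases hij : i = j
    · subst hij
      rw [hx21, one_apply_eq, SimpleGraph.adjMatrix_apply, if_neg (G.loopless.irrefl _)]
      ring
    · rw [one_apply_ne hij]
      by_cases ha : G.Adj i j
      · rw [h.count_adj i i.2 j j.2 ha, SimpleGraph.adjMatrix_apply, if_pos ha]
        ring
      · rw [h.count_not_adj i i.2 j j.2 (fun e => hij (Subtype.ext e)) ha,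
          SimpleGraph.adjMatrix_apply, if_neg ha]
        ring
  · intro j
    simp only [incidenceMatrix_neighborBlock, hA _ (j : V)]
    rw [sum_eq_commonCount, hx21]
  · intro q
    simp only [incidenceMatrix_neighborBlock]
    rw [sum_eq_commonCount, hx12]
  · refine ⟨⟨u₀, hu₀⟩, ⟨v₀, hv₀⟩, ⟨u₁, hu₁⟩, ⟨v₁, hv₁⟩, ?_⟩
    rw [incidenceMatrix_neighborBlock, incidenceMatrix_neighborBlock]
    simp [SimpleGraph.adjMatrix_apply, ha₀, ha₁]
  · by_contra! hc
    obtain ⟨a, ha, b, hb, hab⟩ := h.exists_adj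
    obtain ⟨c, hc', d, hd, hcd, hcd'⟩ := h.exists_not_adj
    -- Otherwise every vertex of Y would be adjacent to all or to none of the others. Following this
    -- from an edge to a non-adjacent pair gives a contradiction.
    have key : ∀ i ∈ Y, ∀ j ∈ Y, ∀ k ∈ Y, k ≠ i → k ≠ j → (G.Adj k i ↔ G.Adj k j) := by
      intro i hi j hj k hk hki hkj
      have := hc ⟨i, hi⟩ ⟨j, hj⟩ ⟨k, hk⟩ (fun e => hki (Subtype.ext_iff.1 e))
        fun e => hkj (Subtype.ext_iff.1 e)
      rw [hN, hN, SimpleGraph.adjMatrix_apply, SimpleGraph.adjMatrix_apply] at this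
      by_cases h1 : G.Adj k i <;> by_cases h2 : G.Adj k j <;> simp_all
    by_cases hac : a = c
    · subst hac
      exact hcd' ((key b hb d hd a ha hab.ne hcd).1 hab)
    · have h1 : G.Adj a c := (key b hb c hc' a ha hab.ne hac).1 hab
      exact hcd' ((key a ha d hd c hc' (Ne.symm hac) hcd).1 h1.symm)
  · have : 0 < commonCount G X v₀ v₀ := by
      rw [commonCount_self]
      exact Finset.card_pos.2 ⟨u₀, by simp [hu₀, ha₀.symm]⟩
    rw [h.count₂₁ v₀ hv₀] at this
    exact_mod_cast this.ne'

theorem HasParameters.isQSD (h : HasParameters G X Y p k₁₁ k₁₂ k₂₁ k₂₂ lam x y) (hxy : x ≠ y)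
    (hk : 1 ≤ k₂₁) : IsQSD (neighborBlock G X Y) X.card k₂₁ lam Y.card k₁₂ x y := by
  have hx21 : ∀ j : ↥(Y : Set V), commonCount G X j j = k₂₁ := fun j => h.count₂₁ j j.2
  obtain ⟨a, ha, b, hb, hab⟩ := h.exists_adj
  obtain ⟨c, hc, d, hd, hcd, hcd'⟩ := h.exists_not_adj
  refine ⟨⟨by simp, hk, ?_, ?_, ?_⟩, by simp, ?_, hxy, ?_, ?_, ?_⟩
  · rw [← h.count₂₁ a ha]
    exact Finset.card_filter_le _ _
  · intro i
    rw [card_neighborBlock, hx21]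
  · intro q r hqr
    rw [card_filter_mem_neighborBlock]
    exact h.count_left q q.2 r r.2 fun e => hqr (Subtype.ext e)
  · intro q
    rw [← h.count₁₂ q q.2, ← card_filter_mem_neighborBlock]
    simp only [and_self]
  · intro i j hij
    rw [card_neighborBlock_inter]
    by_cases hadj : G.Adj i j
    · exact Or.inl (h.count_adj i i.2 j j.2 hadj)
    · exact Or.inr (h.count_not_adj i i.2 j j.2 (fun e => hij (Subtype.ext e)) hadj)
  · refine ⟨⟨a, ha⟩, ⟨b, hb⟩, fun e => hab.ne (Subtype.ext_iff.1 e), ?_⟩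
    rw [card_neighborBlock_inter]
    exact h.count_adj a ha b hb hab
  · refine ⟨⟨c, hc⟩, ⟨d, hd⟩, fun e => hcd (Subtype.ext_iff.1 e), ?_⟩
    rw [card_neighborBlock_inter]
    exact h.count_not_adj c hc d hd hcd hcd'

theorem HasParameters.induce_eq (h : HasParameters G X Y p k₁₁ k₁₂ k₂₁ k₂₂ lam x y) (hxy : x ≠ y) :
    G.induce (Y : Set V) = blockGraph (neighborBlock G X Y) x := by
  ext i j
  simp only [SimpleGraph.comap_adj, Function.Embedding.subtype_apply, blockGraph]
  rw [card_neighborBlock_inter]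
  constructor
  · exact fun hadj => ⟨fun e => hadj.ne (by rw [e]), h.count_adj i i.2 j j.2 hadj⟩
  · rintro ⟨hij, hc⟩
    by_contra hadj
    exact hxy (hc.symm.trans
      (h.count_not_adj i i.2 j j.2 (fun e => hij (Subtype.ext e)) hadj))

theorem HasParameters.submatrix_eq [Decidable p]
    (h : HasParameters G X Y p k₁₁ k₁₂ k₂₁ k₂₂ lam x y) :
    (G.adjMatrix ℝ).submatrix
      (Sum.elim (Subtype.val : ↥(X : Set V) → V) (Subtype.val : ↥(Y : Set V) → V))
      (Sum.elim (Subtype.val : ↥(X : Set V) → V) (Subtype.val : ↥(Y : Set V) → V)) =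
    Matrix.fromBlocks ((if p then (1 : ℝ) else 0) • (allOnes ↥(X : Set V) ↥(X : Set V) ℝ - 1))
      (incidenceMatrix (neighborBlock G X Y)) (incidenceMatrix (neighborBlock G X Y)).transpose
      ((G.induce (Y : Set V)).adjMatrix ℝ) := by
  ext (q | i) (r | j)
  · simp only [submatrix_apply, Sum.elim_inl, fromBlocks_apply₁₁, Matrix.smul_apply,
      Matrix.sub_apply, allOnes, of_apply, smul_eq_mul]
    by_cases hqr : q = r
    · subst hqr
      simp
    · rw [one_apply_ne hqr, SimpleGraph.adjMatrix_apply, sub_zero, mul_one]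
      exact if_congr (h.adj_left q q.2 r r.2 fun e => hqr (Subtype.ext e)) rfl rfl
  · exact (incidenceMatrix_neighborBlock q j).symm
  · refine Eq.trans ?_ (incidenceMatrix_neighborBlock r i).symm
    simp [SimpleGraph.adjMatrix_apply, G.adj_comm]
  · simp [SimpleGraph.adjMatrix_apply]

theorem IsFibrePair.isBiregular (h : IsFibrePair G X Y) {a b : V} (ha : a ∈ X) (hb : b ∈ Y) :
    IsBiregular G (G.degree a) (G.degree b) X Y := by
  have h1 : ∀ u ∈ X, G.degree u = G.degree a := fun u hu =>
    degree_eq_of_fibre_eq ((h.left_fibre a ha u).1 hu)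
  have h2 : ∀ u ∈ Y, G.degree u = G.degree b := fun u hu =>
    degree_eq_of_fibre_eq ((h.right_fibre b hb u).1 hu)
  have hne := h.degree_ne a ha b hb
  refine ⟨hne, ?_, fun u => ⟨h1 u, fun e => ?_⟩, fun u => ⟨h2 u, fun e => ?_⟩⟩
  · ext k
    simp only [Set.mem_range, Set.mem_insert_iff, Set.mem_singleton_iff]
    constructor
    · rintro ⟨u, rfl⟩
      exact (h.cover u).imp (h1 u) (h2 u)
    · rintro (rfl | rfl)
      exacts [⟨a, rfl⟩, ⟨b, rfl⟩]
  · exact (h.cover u).resolve_right fun hu => hne (e.symm.trans (h2 u hu))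
  · exact (h.cover u).resolve_left fun hu => hne ((h1 u hu).symm.trans e)

end assemble

/-- The relations between the eigenvalues of a graph in `𝒢₃(θ₀, θ₁, θ₂)` and those of its
block graph. -/
theorem IsDesignBlock.eigenvalue_relations {P B : Type*} [Fintype P] [DecidableEq P] [Fintype B]
    [DecidableEq B] {M : Matrix P B ℝ} {N : Matrix B B ℝ} {ε θ₁ θ₂ β γ a b lam x y : ℝ}
    (h : IsDesignBlock M N ε (θ₁ + θ₂) (θ₁ * θ₂) β γ a b lam x y) (hε : ε = 0 ∨ ε = 1)
    (hθ : θ₂ < θ₁) (hlam : lam ≤ b) {e f : ℝ} (he : e = (y - a) / (x - y))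
    (hf : f = (b - lam + y - a) / (x - y)) :
    f = θ₁ + θ₂ + ε ∧
    ((θ₁ = max e f ∧ max e f = e) ∨ (θ₂ = min e f ∧ min e f = e)) ∧
    x = a + (θ₁ + 1) * (θ₂ + 1) - (max e f + 1) * (min e f + 1) ∧
    y = a + θ₁ * θ₂ - max e f * min e f := by
  have hxy : x - y ≠ 0 := sub_ne_zero.2 h.ne
  have hf' : f = θ₁ + θ₂ + ε := by
    rw [hf, ← h.coeff_eq.1, mul_div_cancel_left₀ _ hxy]
  have hb : lam < b := by
    obtain ⟨-, -, -, -, -, hb⟩ := h.exists_eigenvector_add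
    exact lt_of_le_of_ne hlam hb.symm
  have h1 := h.sub_eq_add
  have h2 := h.ker_eigenvalue_sq
  obtain ⟨h3, h4⟩ := h.vieta
  rw [← he] at h2 h3 h4
  have hroot : e = θ₁ ∨ e = θ₂ := by
    have : (e - θ₁) * (e - θ₂) = 0 := by linear_combination h2
    rcases mul_eq_zero.1 this with h | h
    exacts [Or.inl (sub_eq_zero.1 h), Or.inr (sub_eq_zero.1 h)]
  -- For ε ∈ {0, 1} this product is lam - b by `sub_eq_add`.
  have hprod : (θ₁ + ε) * (θ₂ + ε) < 0 := by
    rcases hε with rfl | rfl <;> linarith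
  have hneg : θ₂ + ε < 0 := by
    by_contra hc
    exact absurd hprod (not_lt.2 (mul_nonneg (by linarith) (not_lt.1 hc)))
  have hpos : 0 < θ₁ + ε := by
    by_contra hc
    exact absurd hprod (not_lt.2 (mul_nonneg_of_nonpos_of_nonpos (not_lt.1 hc) hneg.le))
  refine ⟨hf', ?_, ?_, ?_⟩
  -- If e = θ₁ then f - e = θ₂ + ε < 0; if e = θ₂ then f - e = θ₁ + ε > 0.
  · rcases hroot with hr | hr
    · exact Or.inl ⟨by rw [max_eq_left (by linarith), hr], max_eq_left (by linarith)⟩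
    · exact Or.inr ⟨by rw [min_eq_left (by linarith), hr], min_eq_left (by linarith)⟩
  -- Vieta's formulas are symmetric in e and f, so the order of the eigenvalues plays no part here.
  · linear_combination max_mul_min e f + max_add_min e f + h3 + h4 + (1 + e) * hf'
  · linear_combination max_mul_min e f + h4 + e * hf'

theorem commonCount_le_self {V : Type*} {G : SimpleGraph V} [DecidableRel G.Adj] (Z : Finset V)
    (u v : V) : commonCount G Z u v ≤ commonCount G Z u u :=
  Finset.card_le_card fun z hz => by
    simp only [Finset.mem_filter] at hz ⊢
    exact ⟨hz.1, hz.2.1, hz.2.1⟩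

theorem degree_add_eq_sq {V : Type*} [Fintype V] [DecidableEq V] {G : SimpleGraph V}
    [DecidableRel G.Adj] {α : V → ℝ} {τ δ : ℝ}
    (hsq : ∀ x y, (G.adjMatrix ℝ * G.adjMatrix ℝ) x y =
      τ * G.adjMatrix ℝ x y - δ * (1 : Matrix V V ℝ) x y + α x * α y) (u : V) :
    (G.degree u : ℝ) + δ = α u * α u := by
  have := hsq u u
  rw [SimpleGraph.adjMatrix_mul_self_apply_self] at this
  simp only [SimpleGraph.adjMatrix_apply, SimpleGraph.irrefl, if_false, one_apply_eq] at this
  linarith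

end ThreeEv

theorem theorem5p5 {V : Type*} [Fintype V] [DecidableEq V] (G : SimpleGraph V)
    [DecidableRel G.Adj] (hG : InG3 G) (hrank : coherentRank G = 9) :
    HasType (coherentClosure G) !![2, 2; 2, 3] ∧
    ∃ (k₁ k₂ k₁₁ k₁₂ k₂₁ k₂₂ lam x y : ℕ) (V₁ V₂ : Finset V)
      (blk : ↥(V₂ : Set V) → Finset ↥(V₁ : Set V)) (ε : ℝ),
      -- the two valency classes are the two fibres
      IsBiregular G k₁ k₂ V₁ V₂ ∧
      HasTypeWith (coherentClosure G) ![(V₁ : Set V), (V₂ : Set V)] !![2, 2; 2, 3] ∧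
      IsEquitable G ![V₁, V₂] !![k₁₁, k₁₂; k₂₁, k₂₂] ∧
      -- the adjacency matrix, and the quasi-symmetric design with its block graph
      (ε = 0 ∨ ε = 1) ∧
      IsQSD blk V₁.card k₂₁ lam V₂.card k₁₂ x y ∧
      G.induce (V₂ : Set V) = blockGraph blk x ∧
      (G.adjMatrix ℝ).submatrix (Sum.elim (Subtype.val : ↥(V₁ : Set V) → V) (Subtype.val : ↥(V₂ : Set V) → V))
          (Sum.elim (Subtype.val : ↥(V₁ : Set V) → V) (Subtype.val : ↥(V₂ : Set V) → V)) =
        Matrix.fromBlocks (ε • (allOnes ↥(V₁ : Set V) ↥(V₁ : Set V) ℝ - 1)) (incidenceMatrix blk)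
          (incidenceMatrix blk).transpose ((G.induce (V₂ : Set V)).adjMatrix ℝ) ∧
      -- the restricted eigenvalues of the block graph, and the relations between the parameters
      ∃ e₁ e₂ : ℝ, e₂ < e₁ ∧ restrictedEigenvalues (G.induce (V₂ : Set V)) = {e₁, e₂} ∧
        ∀ θ₀ θ₁ θ₂ : ℝ, InG3With G θ₀ θ₁ θ₂ →
          ((θ₁ = e₁ ∧ e₁ = ((y : ℝ) - k₂₁) / ((x : ℝ) - y)) ∨
            (θ₂ = e₂ ∧ e₂ = ((y : ℝ) - k₂₁) / ((x : ℝ) - y))) ∧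
          (x : ℝ) = k₂₁ + (θ₁ + 1) * (θ₂ + 1) - (e₁ + 1) * (e₂ + 1) ∧
          (y : ℝ) = k₂₁ + θ₁ * θ₂ - e₁ * e₂ ∧
          0 ≤ (k₁ + θ₁ * θ₂) * (k₂ + θ₁ * θ₂) ∧
          (G.induce (V₁ : Set V) = ⊥ →
            (lam : ℝ) - k₁₂ = θ₁ * θ₂ ∧
            ((k₁₂ : ℝ) - lam + y - k₂₁) / ((x : ℝ) - y) = θ₁ + θ₂ ∧
            Real.sqrt ((k₁ + θ₁ * θ₂) * (k₂ + θ₁ * θ₂)) =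
              ((lam : ℝ) * k₂₁ - y * k₁₂) / ((x : ℝ) - y)) ∧
          (G.induce (V₁ : Set V) = ⊤ →
            (lam : ℝ) - k₁₂ = (θ₁ + 1) * (θ₂ + 1) ∧
            ((k₁₂ : ℝ) - lam + y - k₂₁) / ((x : ℝ) - y) = θ₁ + θ₂ + 1 ∧
            Real.sqrt ((k₁ + θ₁ * θ₂) * (k₂ + θ₁ * θ₂)) =
              k₂₁ + ((lam : ℝ) * k₂₁ - y * k₁₂) / ((x : ℝ) - y)) := by
  classical
  obtain ⟨t₀, t₁, t₂, hGt⟩ := hG.exists_inG3With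
  obtain ⟨α, hα, hsq⟩ := hGt.exists_pos_vector
  obtain ⟨X, Y, hF, h11, h12, h22⟩ :=
    exists_isFibrePair_relationCount hG.1 hα hsq hrank
  obtain ⟨p, k₁₁, k₁₂, k₂₁, k₂₂, lam, x, y, hP⟩ := hF.exists_hasParameters hα hsq h11 h22
  obtain ⟨a, ha⟩ := hF.left_nonempty
  obtain ⟨b, hb⟩ := hF.right_nonempty
  have htype := hF.hasTypeWith h11 h12 h22
  have hbi := hF.isBiregular ha hb
  -- Kept general in θ₁, θ₂ and α, since the conclusion quantifies over the eigenvalues after the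
  -- design has been fixed.
  have hblock : ∀ {θ₁ θ₂ : ℝ} {α : V → ℝ}, (∀ x, 0 < α x) →
      (∀ x y, (G.adjMatrix ℝ * G.adjMatrix ℝ) x y =
        (θ₁ + θ₂) * G.adjMatrix ℝ x y - θ₁ * θ₂ * (1 : Matrix V V ℝ) x y + α x * α y) →
      IsDesignBlock (incidenceMatrix (neighborBlock G X Y))
        ((G.induce (Y : Set V)).adjMatrix ℝ) (if p then 1 else 0) (θ₁ + θ₂) (θ₁ * θ₂)
        (α b * α b) (α a * α b) k₂₁ k₁₂ lam x y := fun hα hsq =>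
    hP.isDesignBlock hF (hF.exists_adj hG.1) (hF.exists_not_adj hα hsq hrank) hsq
      (fun u hu => eq_of_degree_eq hα hsq (((hbi.mem₁ u).1 hu)))
      (fun u hu => eq_of_degree_eq hα hsq (((hbi.mem₂ u).1 hu)))
  have hD := hblock hα hsq
  have hxy : x ≠ y := fun e => hD.ne (by rw [e])
  have hk : 1 ≤ k₂₁ := Nat.one_le_iff_ne_zero.2 fun e => hD.size_ne (by rw [e, Nat.cast_zero])
  have hε : (if p then (1 : ℝ) else 0) = 0 ∨ (if p then (1 : ℝ) else 0) = 1 := by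
    split_ifs <;> simp
  obtain ⟨u, hu, v, hv, huv⟩ := Finset.one_lt_card.1 hP.one_lt_card
  have hlam : (lam : ℝ) ≤ k₁₂ := by
    rw [← hP.count_left u hu v hv huv, ← hP.count₁₂ u hu]
    exact_mod_cast commonCount_le_self Y u v
  -- Both eigenvalues are written in the design parameters alone, so e₁ and e₂ can be named before
  -- θ₁ and θ₂.
  set e : ℝ := ((y : ℝ) - k₂₁) / ((x : ℝ) - y) with he
  set f : ℝ := ((k₁₂ : ℝ) - lam + y - k₂₁) / ((x : ℝ) - y) with hf
  have hfe : f ≠ e := by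
    rw [(hD.eigenvalue_relations hε hGt.2.2.1 hlam he hf).1]
    exact hD.eigenvalue_ne
  refine ⟨⟨_, htype⟩, G.degree a, G.degree b, k₁₁, k₁₂, k₂₁, k₂₂, lam, x, y, X, Y,
    neighborBlock G X Y, if p then 1 else 0, hbi, htype, hP.isEquitable, hε, hP.isQSD hxy hk,
    hP.induce_eq hxy, hP.submatrix_eq, max e f, min e f, min_lt_max.2 hfe.symm, ?_, ?_⟩
  · have := hD.restricted_eq
    rw [← (hD.eigenvalue_relations hε hGt.2.2.1 hlam he hf).1, ← he] at this
    refine Eq.trans this ?_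
    rcases le_total e f with h | h
    · rw [max_eq_right h, min_eq_left h]
    · rw [max_eq_left h, min_eq_right h, Set.pair_comm]
  · intro θ₀ θ₁ θ₂ hGθ
    obtain ⟨α', hα', hsq'⟩ := hGθ.exists_pos_vector
    have hD' := hblock hα' hsq'
    obtain ⟨hf', h1, h2, h3⟩ := hD'.eigenvalue_relations hε hGθ.2.2.1 hlam he hf
    have hprod : ((G.degree a : ℝ) + θ₁ * θ₂) * (G.degree b + θ₁ * θ₂) =
        (α' a * α' b) * (α' a * α' b) := by
      rw [degree_add_eq_sq hsq' a, degree_add_eq_sq hsq' b]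
      ring
    -- The root is α₁α₂, the constant γ of the off-diagonal block, and the second identity of
    -- `coeff_eq` expresses it through the design parameters. Positivity of α fixes the sign.
    have hsqrt : √(((G.degree a : ℝ) + θ₁ * θ₂) * (G.degree b + θ₁ * θ₂)) =
        (if p then 1 else 0) * k₂₁ + ((lam : ℝ) * k₂₁ - y * k₁₂) / ((x : ℝ) - y) := by
      rw [hprod, Real.sqrt_mul_self (mul_pos (hα' a) (hα' b)).le, ← hD'.coeff_eq.2,
        mul_div_cancel_left₀ _ (sub_ne_zero.2 hD'.ne)]
      ring
    have hsub := hD'.sub_eq_add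
    refine ⟨h1, h2, h3, hprod ▸ mul_self_nonneg _, fun hbot => ?_, fun htop => ?_⟩
    · have hp : ¬ p := fun hp => by
        have hadj : (G.induce (X : Set V)).Adj ⟨u, hu⟩ ⟨v, hv⟩ :=
          (hP.adj_left u hu v hv huv).2 hp
        simp [hbot] at hadj
      simp only [if_neg hp] at hsqrt hsub hf'
      exact ⟨by linarith, by linarith, by linarith⟩
    · have hp : p := by
        have hadj : (G.induce (X : Set V)).Adj ⟨u, hu⟩ ⟨v, hv⟩ := by
          rw [htop]
          simpa using huv
        exact (hP.adj_left u hu v hv huv).1 hadj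
      simp only [if_pos hp] at hsqrt hsub hf'
      exact ⟨by linarith, by linarith, by linarith⟩
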